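/- **Setting.** Let $E\subset\mathbb R^d$ be a Borel set, $\mu$ a finite measure on $E$, and let $\Theta\subset\mathbb R^p$, $\Lambda\subset\mathbb R^q$ be compact. Let $p^\star$ be a probability density on $E$ with respect to $\mu$, let $Z$ be a random variable in $\mathbb R^{d'}$ (the noise), let $G_\theta:\mathbb R^{d'}\to E$ ($\theta\in\Theta$) be measurable generators such that $G_\theta(Z)$ has a density $p_\theta$ with respect to $\mu$, and let $D_\alpha:E\to[0,1]$ ($\alpha\in\Lambda$) be discriminators. Let $(X_i,Z_i)_{i\ge 1}$ be i.i.d. pairs such that $X_i$ has density $p^\star$ and $Z_i$ is distributed as $Z$ (for instance two independent i.i.d. samples). Put $$L(\theta,\alpha)=\int \ln(D_\alpha)\,p^\star\,d\mu+\int\ln(1-D_\alpha)\,p_\theta\,d\mu,\qquad \ell_i(\theta,\alpha)=\ln D_\alpha(X_i)+\ln\bigl(1-D_\alpha(G_\theta(Z_i))\bigr),$$ and $\hat L_n(\theta,\alpha)=\sum_{i=1}^n\ell_i(\theta,\alpha)$. Let $\hat\theta_n$ be a ($\Theta$-valued, measurable) minimizer over $\Theta$ of $\theta\mapsto\sup_{\alpha\in\Lambda}\hat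 L_n(\theta,\alpha)$, almost surely for each $n$. A function on a subset $S$ of a Euclidean space is said to be of class $C^2$, with differentials of order 1 and 2 bounded by $K$, if it has continuous first and second differentials on $S$ (differentials being taken relative to $S$) whose norms are at most $K$ on $S$. **Assumptions.** * $(H'_{\rm reg})$: (i) there is $\kappa\in(0,1/2)$ with $\kappa\le D_\alpha\le 1-\kappa$ on $E$ for all $\alpha\in\Lambda$, and $(x,\alpha)\mapsto D_\alpha(x)$ is of class $C^2$ on $E\times\Lambda$ with bounded differentials of order 1 and 2; (ii) for every $z\in\mathbb R^{d'}$ the map $\theta\mapsto G_\theta(z)$ is of class $C^2$ on $\Theta$, and it and its differentials of order 1 and 2 are bounded uniformly in $(\theta,z)$; (iii) for every $x\in E$ the map $\theta\mapsto p_\theta(x)$ is of class $C^2$ on $\Theta$, and it and its differentials of order 1 and 2 are bounded uniformly in $(\theta,x)$. * $(H_1)$: there is a unique pair $(\bar\theta,\bar\alpha)\in\Theta\times\Lambda$ such that $\sup_{\alpha\in\Lambda}L(\bar\theta,\alpha)\le\sup_{\alpha\in\Lambda}L(\theta,\alpha)$ for all $\theta\in\Theta$ and $L(\bar\theta,\bar\alpha)\ge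 L(\bar\theta,\alpha)$ for all $\alpha\in\Lambda$; moreover $(\bar\theta,\bar\alpha)\in\Theta^\circ\times\Lambda^\circ$. * $(H_{\rm loc})$: there are a neighborhood $U\subset\Theta$ of $\bar\theta$ and a function $\alpha:U\to\Lambda$ such that $\operatorname{arg\,max}_{\alpha\in\Lambda}L(\theta,\alpha)=\{\alpha(\theta)\}$ for all $\theta\in U$; with $V(\theta)=L(\theta,\alpha(\theta))$, the Hessian matrix $HV(\bar\theta)$ is invertible; and the Hessian matrix $H_2L(\bar\theta,\bar\alpha)$ of $\alpha\mapsto L(\bar\theta,\alpha)$ at $\bar\alpha$ is invertible. Write $\nabla_1,\nabla_2$ for the gradients with respect to $\theta$ and $\alpha$, and $J(g)_t$ for the Jacobian matrix of $g$ at $t$. **Theorem (central limit theorem for $\hat\theta$).** Under $(H'_{\rm reg})$, $(H_1)$ and $(H_{\rm loc})$, the random vector $$W=-HV(\bar\theta)^{-1}\nabla_1\ell_1(\bar\theta,\bar\alpha)+HV(\bar\theta)^{-1}\,J(\nabla_1L(\bar\theta,\cdot))_{\bar\alpha}\,H_2L(\bar\theta,\bar\alpha)^{-1}\,\nabla_2\ell_1(\bar\theta,\bar\alpha)$$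 is square-integrable and, as $n\to\infty$, $\sqrt n\,(\hat\theta_n-\bar\theta)$ converges in distribution to a Gaussian vector with mean $0$ and covariance matrix $\mathbf V=\operatorname{Var}[W]$. -/

import Mathlib

open MeasureTheory ProbabilityTheory Filter Topology Matrix

noncomputable section

/-- The Euclidean space `ℝⁿ`. -/
abbrev Euc (n : ℕ) : Type := EuclideanSpace ℝ (Fin n)

/-- The Jacobian matrix `J(g)_t` of `g : ℝᵐ → ℝᵏ` at `t`, of format `k × m`. -/
def jacobian {m k : ℕ} (g : Euc m → Euc k) (t : Euc m) : Matrix (Fin k) (Fin m) ℝ :=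
  Matrix.of fun i j => (fderiv ℝ g t (EuclideanSpace.single j 1)) i

/-- The Hessian matrix `HF(x)` of `F : ℝᵐ → ℝ` at `x` (the Jacobian of the gradient). -/
def hessian {m : ℕ} (F : Euc m → ℝ) (x : Euc m) : Matrix (Fin m) (Fin m) ℝ :=
  jacobian (gradient F) x

/-- The covariance matrix `Var[W]` of a random vector `W`. -/
def covMat {Ω : Type*} [MeasurableSpace Ω] (P : Measure Ω) {m : ℕ} (W : Ω → Euc m) :
    Matrix (Fin m) (Fin m) ℝ :=
  Matrix.of fun i j => covariance (fun ω => W ω i) (fun ω => W ω j) P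

/-- `f` is of class `C²` on the (arbitrary) set `s`, with differentials of order 1 and 2 bounded
by `K` on `s`. The differentials are the terms of order 1 and 2 of a Taylor series of `f`
on `s`; where `s` determines them uniquely (for instance in its interior) they are the usual
ones. -/
def IsC2BoundedOn {V W : Type*} [NormedAddCommGroup V] [NormedSpace ℝ V]
    [NormedAddCommGroup W] [NormedSpace ℝ W] (f : V → W) (s : Set V) (K : ℝ) : Prop :=
  ∃ T : V → FormalMultilinearSeries ℝ V W, HasFTaylorSeriesUpToOn 2 f T s ∧
    ∀ x ∈ s, ‖T x 1‖ ≤ K ∧ ‖T x 2‖ ≤ K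

/-- The data of a parametric adversarial model: a finite dominating measure `μ` on a Borel set
`E ⊆ ℝᵈ`, compact parameter sets `Θ ⊆ ℝᵖ`, `Λ ⊆ ℝ^q`, the law `noise` of the noise variable on
`ℝ^{d'}`, the target density `pstar`, the generators `G θ : ℝ^{d'} → E`, their densities `dens θ`
(the law of `G θ (Z)` is `dens θ dμ`), and the discriminators `D α`.
All functions on `E` are written as functions on `ℝᵈ`, whose values off `E` are irrelevant. -/
structure GANModel (d d' p q : ℕ) where
  E : Set (Euc d)
  measurableSet_E : MeasurableSet E
  μ : Measure (Euc d)
  finite_μ : IsFiniteMeasure μ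
  μ_compl_E : μ Eᶜ = 0
  Θ : Set (Euc p)
  isCompact_Θ : IsCompact Θ
  Λ : Set (Euc q)
  isCompact_Λ : IsCompact Λ
  noise : Measure (Euc d')
  prob_noise : IsProbabilityMeasure noise
  pstar : Euc d → ℝ
  measurable_pstar : Measurable pstar
  pstar_nonneg : ∀ x ∈ E, 0 ≤ pstar x
  lintegral_pstar : ∫⁻ x, ENNReal.ofReal (pstar x) ∂μ = 1
  G : Euc p → Euc d' → Euc d
  measurable_G : ∀ θ ∈ Θ, Measurable (G θ)
  G_mem : ∀ θ ∈ Θ, ∀ z, G θ z ∈ E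
  dens : Euc p → Euc d → ℝ
  measurable_dens : ∀ θ ∈ Θ, Measurable (dens θ)
  dens_nonneg : ∀ θ ∈ Θ, ∀ x ∈ E, 0 ≤ dens θ x
  map_G : ∀ θ ∈ Θ, noise.map (G θ) = μ.withDensity fun x => ENNReal.ofReal (dens θ x)
  D : Euc q → Euc d → ℝ

namespace GANModel

variable {d d' p q : ℕ}

/-- `L(θ, α) = ∫ ln(D_α) p⋆ dμ + ∫ ln(1 - D_α) p_θ dμ`. -/
def L (M : GANModel d d' p q) (θ : Euc p) (α : Euc q) : ℝ :=
  (∫ x, Real.log (M.D α x) * M.pstar x ∂M.μ) + ∫ x, Real.log (1 - M.D α x) * M.dens θ x ∂M.μ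

/-- `ln D_α(x) + ln(1 - D_α(G_θ(z)))`, the contribution of one observation `x` and one
noise value `z`. -/
def ell (M : GANModel d d' p q) (x : Euc d) (z : Euc d') (θ : Euc p) (α : Euc q) : ℝ :=
  Real.log (M.D α x) + Real.log (1 - M.D α (M.G θ z))

/-- `L̂(θ, α) = ∑ᵢ ln D_α(Xᵢ) + ∑ᵢ ln(1 - D_α(G_θ(Zᵢ)))`, the sums being over the first `n`
terms of the sequences `x` and `z`. -/
def Lhat (M : GANModel d d' p q) (n : ℕ) (x : ℕ → Euc d) (z : ℕ → Euc d')
    (θ : Euc p) (α : Euc q) : ℝ :=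
  (∑ i ∈ Finset.range n, Real.log (M.D α (x i))) +
    (∑ i ∈ Finset.range n, Real.log (1 - M.D α (M.G θ (z i))))

/-- `θ` minimizes `sup_{α ∈ Λ} F(·, α)` over `Θ`. -/
def IsInfSup (M : GANModel d d' p q) (F : Euc p → Euc q → ℝ) (θ : Euc p) : Prop :=
  θ ∈ M.Θ ∧ ∀ θ' ∈ M.Θ, (⨆ α : M.Λ, F θ α) ≤ (⨆ α : M.Λ, F θ' α)

/-- The set `argmax_{α ∈ Λ} F(θ, α)`. -/
def argmax (M : GANModel d d' p q) (F : Euc p → Euc q → ℝ) (θ : Euc p) : Set (Euc q) :=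
  {α | α ∈ M.Λ ∧ ∀ α' ∈ M.Λ, F θ α' ≤ F θ α}

/-- The `C²` regularity assumptions on discriminators, generators and densities. -/
structure HReg (M : GANModel d d' p q) : Prop where
  regD : (∃ κ : ℝ, 0 < κ ∧ κ < 1 / 2 ∧ ∀ α ∈ M.Λ, ∀ x ∈ M.E, κ ≤ M.D α x ∧ M.D α x ≤ 1 - κ) ∧
    ∃ K : ℝ, IsC2BoundedOn (fun w : Euc d × Euc q => M.D w.2 w.1) (M.E ×ˢ M.Λ) K
  regG : ∃ K : ℝ, ∀ z : Euc d', (∀ θ ∈ M.Θ, ‖M.G θ z‖ ≤ K) ∧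
    IsC2BoundedOn (fun θ => M.G θ z) M.Θ K
  regp : ∃ K : ℝ, ∀ x ∈ M.E, (∀ θ ∈ M.Θ, |M.dens θ x| ≤ K) ∧
    IsC2BoundedOn (fun θ => M.dens θ x) M.Θ K

/-- `(θ₀, α₀)` is the unique pair such that `θ₀` minimizes `sup_α L(·, α)` over `Θ` and `α₀`
maximizes `L(θ₀, ·)` over `Λ`, and it is interior to `Θ × Λ`. -/
structure HOne (M : GANModel d d' p q) (θ₀ : Euc p) (α₀ : Euc q) : Prop where
  isInfSup : M.IsInfSup M.L θ₀
  mem_argmax : α₀ ∈ M.argmax M.L θ₀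
  unique : ∀ θ α, M.IsInfSup M.L θ → α ∈ M.argmax M.L θ → θ = θ₀ ∧ α = α₀
  mem_interior_Θ : θ₀ ∈ interior M.Θ
  mem_interior_Λ : α₀ ∈ interior M.Λ

/-- The function `V(θ) = L(θ, α(θ))`. -/
def V (M : GANModel d d' p q) (a : Euc p → Euc q) (θ : Euc p) : ℝ := M.L θ (a θ)

/-- The local assumptions at `(θ₀, α₀)`, for a neighborhood `U` of `θ₀` and a function
`a : U → Λ` (written as a function on `ℝᵖ`). -/
structure HLoc (M : GANModel d d' p q) (θ₀ : Euc p) (α₀ : Euc q) (U : Set (Euc p))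
    (a : Euc p → Euc q) : Prop where
  mem_nhds : U ∈ 𝓝 θ₀
  subset_Θ : U ⊆ M.Θ
  argmax_eq : ∀ θ ∈ U, M.argmax M.L θ = {a θ}
  isUnit_HV : IsUnit (hessian (M.V a) θ₀)
  isUnit_H2L : IsUnit (hessian (fun α => M.L θ₀ α) α₀)

/-- The random vectors `(Xᵢ, Zᵢ)` are i.i.d., `Xᵢ` has density `p⋆` with respect to `μ` and
`Zᵢ` is distributed as the noise. -/
structure IsSample (M : GANModel d d' p q) {Ω : Type*} [MeasurableSpace Ω] (P : Measure Ω)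
    (X : ℕ → Ω → Euc d) (Z : ℕ → Ω → Euc d') : Prop where
  measurable_X : ∀ i, Measurable (X i)
  measurable_Z : ∀ i, Measurable (Z i)
  indep : iIndepFun (fun i ω => (X i ω, Z i ω)) P
  identDistrib : ∀ i, IdentDistrib (fun ω => (X i ω, Z i ω)) (fun ω => (X 0 ω, Z 0 ω)) P P
  map_X : P.map (X 0) = M.μ.withDensity fun x => ENNReal.ofReal (M.pstar x)
  map_Z : P.map (Z 0) = M.noise

/-- The vector
`-HV(θ₀)⁻¹ ∇₁ℓ(θ₀, α₀) + HV(θ₀)⁻¹ J(∇₁L(θ₀, ·))_{α₀} H₂L(θ₀, α₀)⁻¹ ∇₂ℓ(θ₀, α₀)`,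
where `ℓ` is built from the observation `x` and the noise value `z`. -/
def influence (M : GANModel d d' p q) (θ₀ : Euc p) (α₀ : Euc q) (a : Euc p → Euc q)
    (x : Euc d) (z : Euc d') : Euc p :=
  WithLp.toLp 2
    (-((hessian (M.V a) θ₀)⁻¹ *ᵥ (gradient (fun θ => M.ell x z θ α₀) θ₀).ofLp) +
      ((hessian (M.V a) θ₀)⁻¹ * jacobian (fun α => gradient (fun θ => M.L θ α) θ₀) α₀ *
        (hessian (fun α => M.L θ₀ α) α₀)⁻¹) *ᵥ (gradient (fun α => M.ell x z θ₀ α) α₀).ofLp)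

end GANModel

end

/-!
The estimator `θhat n` is treated as the first component of a critical point of a smooth random
function, and the theorem follows by linearizing the critical point equation.

Write `f w (θ, α)` for the contribution of an observation `w = (x, z)` (`GANModel.contrib`). By the
change of variables formula the population criterion `L` is the expectation of `f` on `Θ × Λ`
(`GANModel.HReg.L_eq_integral_contrib`), and the chain rule bounds the first two differentials of
`f w`, relative to `Θ × Λ`, uniformly in `w` (`GANModel.HReg.exists_isSmoothFamily`). The strong law
of large numbers in the Banach space `C(K, F)` (`uniform_strong_law`) then gives, almost surely, the
uniform convergence of the empirical means `F n` of `f` to `L` on `Θ × Λ`, and that of their second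
differentials near `t₀ = (θ₀, α₀)`.

The remaining analysis is deterministic (`exists_linearization_of_isMinimaxOn`). By compactness and
uniqueness, `θhat n` and all maximizers of `F n (θhat n, ·)` converge to `θ₀` and `α₀`. Since the
Hessian of `F n` in `α` is close to the invertible `H₂L`, the maximizer `αhat n` is eventually
unique, so that Danskin's envelope principle (`fderiv_inl_eq_zero_of_isMinimaxOn`) applies and
`(θhat n, αhat n) = t₀ + u n` is a critical point of `F n`. The mean value inequality yields
`H (u n) = -D(F n)(t₀) + o(‖D(F n)(t₀)‖)`, where `H` is the second differential of `L` at `t₀`.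

The implicit function theorem shows that `α(θ)` is of class `C¹` near `θ₀` and that `HV` is the
Schur complement of `H₂L` in `H`. Hence `H` is invertible, and block inversion identifies the
first component of `-H⁻¹ g` with the linear map that defines the influence vector
(`exists_fst_inverse_of_schur`). Finally `√n D(F n)(t₀)` is a normalized sum of centered bounded
i.i.d. vectors, and the multivariate central limit theorem with Slutsky's lemma concludes
(`tendstoInDistribution_of_linear_expansion`).
-/

/-! ### Bounded second order calculus on arbitrary sets -/

section C2Calculus

variable {V W X : Type*} [NormedAddCommGroup V] [NormedSpace ℝ V]
  [NormedAddCommGroup W] [NormedSpace ℝ W] [NormedAddCommGroup X] [NormedSpace ℝ X]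

/-- `f` has first and second differentials relative to `s`, bounded by `K` on `s`, the second one
being continuous. The differentials are iterated Fréchet derivatives instead of the terms of a
Taylor series. -/
def C2BddOn (f : V → W) (s : Set V) (K : ℝ) : Prop :=
  ∃ (f' : V → V →L[ℝ] W) (f'' : V → V →L[ℝ] V →L[ℝ] W),
    (∀ x ∈ s, HasFDerivWithinAt f (f' x) s x) ∧
    (∀ x ∈ s, HasFDerivWithinAt f' (f'' x) s x) ∧ ContinuousOn f'' s ∧
    ∀ x ∈ s, ‖f' x‖ ≤ K ∧ ‖f'' x‖ ≤ K

theorem IsC2BoundedOn.c2BddOn {f : V → W} {s : Set V} {K : ℝ} (h : IsC2BoundedOn f s K) :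
    C2BddOn f s K := by
  obtain ⟨T, hT, hK⟩ := h
  let e := continuousMultilinearCurryFin1 ℝ V W
  let A : (V [×1]→L[ℝ] W) →L[ℝ] V →L[ℝ] W := e.toContinuousLinearEquiv.toContinuousLinearMap
  refine ⟨fun x => e (T x 1),
    fun x => A.comp (T x 2).curryLeft, ?_, ?_, ?_, ?_⟩
  · intro x hx
    exact hT.hasFDerivWithinAt (by norm_num) hx
  · intro x hx
    exact A.hasFDerivAt.comp_hasFDerivWithinAt x
      (hT.fderivWithin 1 (by norm_num) x hx)
  · have h2 : ContinuousOn (fun x => T x 2) s := hT.cont 2 le_rfl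
    have h3 : ContinuousOn (fun x => (T x 2).curryLeft) s :=
      (continuousMultilinearCurryLeftEquiv ℝ (fun _ : Fin 2 => V) W).continuous.comp_continuousOn h2
    exact continuousOn_const.clm_comp h3
  · intro x hx
    refine ⟨by simpa using (hK x hx).1, ?_⟩
    refine ContinuousLinearMap.opNorm_le_bound _ ((norm_nonneg _).trans (hK x hx).2) fun v => ?_
    have : ‖e ((T x 2).curryLeft v)‖ ≤ ‖T x 2‖ * ‖v‖ := by
      rw [LinearIsometryEquiv.norm_map]
      exact ((T x 2).curryLeft.le_opNorm v).trans (by rw [ContinuousMultilinearMap.curryLeft_norm])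
    exact this.trans (by gcongr; exact (hK x hx).2)

theorem C2BddOn.mono {f : V → W} {s t : Set V} {K K' : ℝ} (h : C2BddOn f s K) (hts : t ⊆ s)
    (hK : K ≤ K') : C2BddOn f t K' := by
  obtain ⟨f', f'', h1, h2, h3, h4⟩ := h
  exact ⟨f', f'', fun x hx => (h1 x (hts hx)).mono hts, fun x hx => (h2 x (hts hx)).mono hts,
    h3.mono hts, fun x hx => ⟨(h4 x (hts hx)).1.trans hK, (h4 x (hts hx)).2.trans hK⟩⟩

theorem C2BddOn.congr {f g : V → W} {s : Set V} {K : ℝ} (h : C2BddOn f s K)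
    (hfg : ∀ x ∈ s, g x = f x) : C2BddOn g s K := by
  obtain ⟨f', f'', h1, h2⟩ := h
  exact ⟨f', f'', fun x hx => (h1 x hx).congr hfg (hfg x hx), h2⟩

theorem C2BddOn.continuousOn {f : V → W} {s : Set V} {K : ℝ} (h : C2BddOn f s K) :
    ContinuousOn f s := by
  obtain ⟨f', f'', h1, h2⟩ := h
  exact fun x hx => (h1 x hx).continuousWithinAt

theorem ContinuousLinearMap.c2BddOn (A : V →L[ℝ] W) (s : Set V) : C2BddOn A s ‖A‖ :=
  ⟨fun _ => A, fun _ => 0, fun _ _ => A.hasFDerivWithinAt,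
    fun _ _ => hasFDerivWithinAt_const _ _ _, continuousOn_const, fun _ _ =>
      ⟨le_rfl, (norm_zero (E := V →L[ℝ] V →L[ℝ] W)).trans_le (norm_nonneg A)⟩⟩

theorem C2BddOn.add_const {f : V → W} {s : Set V} {K : ℝ} (h : C2BddOn f s K) (c : W) :
    C2BddOn (fun x => f x + c) s K := by
  obtain ⟨f', f'', h1, h2⟩ := h
  exact ⟨f', f'', fun x hx => (h1 x hx).add_const c, h2⟩

theorem C2BddOn.add {f g : V → W} {s : Set V} {K K' : ℝ} (hf : C2BddOn f s K)
    (hg : C2BddOn g s K') : C2BddOn (fun x => f x + g x) s (K + K') := by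
  obtain ⟨f', f'', h1, h2, h3, h4⟩ := hf
  obtain ⟨g', g'', k1, k2, k3, k4⟩ := hg
  exact ⟨fun x => f' x + g' x, fun x => f'' x + g'' x, fun x hx => (h1 x hx).add (k1 x hx),
    fun x hx => (h2 x hx).add (k2 x hx), h3.add k3,
    fun x hx => ⟨(norm_add_le _ _).trans (add_le_add (h4 x hx).1 (k4 x hx).1),
      (norm_add_le (f'' x) (g'' x)).trans (add_le_add (h4 x hx).2 (k4 x hx).2)⟩⟩

theorem C2BddOn.comp {g : W → X} {f : V → W} {s : Set V} {t : Set W} {K K' : ℝ}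
    (hg : C2BddOn g t K') (hf : C2BddOn f s K) (hst : Set.MapsTo f s t) :
    C2BddOn (fun x => g (f x)) s (K' * K + K' * K * K) := by
  have hc := hf.continuousOn
  obtain ⟨f', f'', h1, h2, h3, h4⟩ := hf
  obtain ⟨g', g'', k1, k2, k3, k4⟩ := hg
  have hf' : ContinuousOn f' s := fun x hx => (h2 x hx).continuousWithinAt
  have hg' : ContinuousOn g' t := fun x hx => (k2 x hx).continuousWithinAt
  refine ⟨fun x => (g' (f x)).comp (f' x), fun x =>
    ((ContinuousLinearMap.compL ℝ V W X (g' (f x))).comp (f'' x) +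
      ((ContinuousLinearMap.compL ℝ V W X).flip (f' x)).comp ((g'' (f x)).comp (f' x))),
    fun x hx => (k1 _ (hst hx)).comp x (h1 x hx) hst, fun x hx => ?_, ?_, fun x hx => ?_⟩
  · exact HasFDerivWithinAt.clm_comp ((k2 _ (hst hx)).comp x (h1 x hx) hst) (h2 x hx)
  · have a1 : ContinuousOn (fun x => g' (f x)) s := hg'.comp hc hst
    have a2 : ContinuousOn (fun x => g'' (f x)) s := k3.comp hc hst
    refine ContinuousOn.add ?_ ?_
    · exact ((ContinuousLinearMap.continuous _).comp_continuousOn a1).clm_comp h3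
    · exact ((ContinuousLinearMap.continuous _).comp_continuousOn hf').clm_comp (a2.clm_comp hf')
  · obtain ⟨p1, p2⟩ := h4 x hx
    obtain ⟨q1, q2⟩ := k4 _ (hst hx)
    have hK : 0 ≤ K := (norm_nonneg _).trans p1
    have hK' : 0 ≤ K' := (norm_nonneg _).trans q1
    have b1 : ‖(g' (f x)).comp (f' x)‖ ≤ K' * K :=
      (ContinuousLinearMap.opNorm_comp_le _ _).trans (mul_le_mul q1 p1 (norm_nonneg _) hK')
    refine ⟨b1.trans (le_add_of_nonneg_right (by positivity)), ?_⟩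
    refine (norm_add_le ((ContinuousLinearMap.compL ℝ V W X (g' (f x))).comp (f'' x))
      (((ContinuousLinearMap.compL ℝ V W X).flip (f' x)).comp
        ((g'' (f x)).comp (f' x)))).trans (add_le_add ?_ ?_)
    · refine ContinuousLinearMap.opNorm_le_bound _ (by positivity) fun v => ?_
      calc ‖(g' (f x)).comp (f'' x v)‖ ≤ ‖g' (f x)‖ * ‖f'' x v‖ :=
            ContinuousLinearMap.opNorm_comp_le _ _
        _ ≤ K' * (K * ‖v‖) := by
            gcongr
            exact (ContinuousLinearMap.le_opNorm _ _).trans (by gcongr)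
        _ = K' * K * ‖v‖ := by ring
    · refine ContinuousLinearMap.opNorm_le_bound _ (by positivity) fun v => ?_
      calc ‖(g'' (f x) (f' x v)).comp (f' x)‖ ≤ ‖g'' (f x) (f' x v)‖ * ‖f' x‖ :=
            ContinuousLinearMap.opNorm_comp_le _ _
        _ ≤ (K' * (K * ‖v‖)) * K := by
            gcongr
            refine (ContinuousLinearMap.le_opNorm _ _).trans ?_
            gcongr
            exact (ContinuousLinearMap.le_opNorm _ _).trans (by gcongr)
        _ = K' * K * K * ‖v‖ := by ring

/-- Neither convexity nor regularity of the compact set `s` is needed, because the differentials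
are those of `f` on the surrounding open set `u`. -/
theorem ContDiffOn.exists_c2BddOn {f : V → W} {s u : Set V} (hf : ContDiffOn ℝ 2 f u)
    (hu : IsOpen u) (hs : IsCompact s) (hsu : s ⊆ u) : ∃ K, C2BddOn f s K := by
  have hf' : ContDiffOn ℝ 1 (fderiv ℝ f) u := hf.fderiv_of_isOpen hu (by norm_num)
  have hf'' : ContDiffOn ℝ 0 (fderiv ℝ (fderiv ℝ f)) u := hf'.fderiv_of_isOpen hu (by norm_num)
  obtain ⟨K1, hK1⟩ := hs.exists_bound_of_continuousOn (E := V →L[ℝ] W) (hf'.continuousOn.mono hsu)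
  obtain ⟨K2, hK2⟩ := hs.exists_bound_of_continuousOn (E := V →L[ℝ] V →L[ℝ] W) (hf''.continuousOn.mono hsu)
  refine ⟨max K1 K2, fderiv ℝ f, fderiv ℝ (fderiv ℝ f), fun x hx => ?_, fun x hx => ?_,
    hf''.continuousOn.mono hsu,
    fun x hx => ⟨(hK1 x hx).trans (le_max_left _ _), (hK2 x hx).trans (le_max_right _ _)⟩⟩
  · exact ((hf.contDiffAt (hu.mem_nhds (hsu hx))).differentiableAt
      (by norm_num)).hasFDerivAt.hasFDerivWithinAt
  · exact ((hf'.contDiffAt (hu.mem_nhds (hsu hx))).differentiableAt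
      (by norm_num)).hasFDerivAt.hasFDerivWithinAt

/-- On an open set the differentials in `C2BddOn` are the Fréchet derivatives. -/
theorem C2BddOn.fderiv_of_isOpen {f : V → W} {s : Set V} {K : ℝ} (h : C2BddOn f s K)
    (hs : IsOpen s) :
    (∀ x ∈ s, HasFDerivAt f (fderiv ℝ f x) x) ∧
    (∀ x ∈ s, HasFDerivAt (fderiv ℝ f) (fderiv ℝ (fderiv ℝ f) x) x) ∧
    ContinuousOn (fderiv ℝ (fderiv ℝ f)) s ∧
    ∀ x ∈ s, ‖fderiv ℝ f x‖ ≤ K ∧ ‖fderiv ℝ (fderiv ℝ f) x‖ ≤ K := by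
  obtain ⟨f', f'', h1, h2, h3, h4⟩ := h
  have e1 : ∀ x ∈ s, HasFDerivAt f (f' x) x := fun x hx => (h1 x hx).hasFDerivAt (hs.mem_nhds hx)
  have e2 : ∀ x ∈ s, HasFDerivAt (fderiv ℝ f) (f'' x) x := fun x hx =>
    ((h2 x hx).hasFDerivAt (hs.mem_nhds hx)).congr_of_eventuallyEq <| by
      filter_upwards [hs.mem_nhds hx] with y hy using (e1 y hy).fderiv
  refine ⟨fun x hx => (e1 x hx).differentiableAt.hasFDerivAt,
    fun x hx => (e2 x hx).differentiableAt.hasFDerivAt,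
    h3.congr fun x hx => (e2 x hx).fderiv, fun x hx => ?_⟩
  rw [(e1 x hx).fderiv, (e2 x hx).fderiv]
  exact h4 x hx

end C2Calculus

/-! ### Uniform laws of large numbers -/

/-- A map into a space of continuous functions on a compact space is measurable as soon as its
evaluations are: closed balls are countable intersections of conditions on evaluations at the
points of a dense sequence. -/
theorem ContinuousMap.measurable_of_eval {𝒲 K F : Type*} [MeasurableSpace 𝒲]
    [TopologicalSpace K] [CompactSpace K] [T2Space K] [SecondCountableTopology K]
    [NormedAddCommGroup F] [SecondCountableTopology F] [MeasurableSpace F] [BorelSpace F]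
    [MeasurableSpace C(K, F)] [BorelSpace C(K, F)]
    {Φ : 𝒲 → C(K, F)} (h : ∀ k, Measurable fun w => Φ w k) : Measurable Φ := by
  have hclosed : ∀ (g : C(K, F)) (r : ℝ), MeasurableSet {w | dist (Φ w) g ≤ r} := by
    intro g r
    obtain ⟨s, hs, hd⟩ := TopologicalSpace.exists_countable_dense K
    rcases lt_or_ge r 0 with hr | hr
    · have : {w | dist (Φ w) g ≤ r} = ∅ := by
        ext w
        simpa using hr.trans_le dist_nonneg
      rw [this]
      exact MeasurableSet.empty
    · have : {w | dist (Φ w) g ≤ r} = ⋂ k ∈ s, {w | dist (Φ w k) (g k) ≤ r} := by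
        ext w
        simp only [Set.mem_ofPred_eq, Set.mem_iInter]
        rw [ContinuousMap.dist_le hr]
        refine ⟨fun H k _ => H k, fun H => ?_⟩
        have hcl : IsClosed {k | dist (Φ w k) (g k) ≤ r} :=
          isClosed_le (by fun_prop) continuous_const
        have : closure s ⊆ {k | dist (Φ w k) (g k) ≤ r} := closure_minimal H hcl
        exact fun k => this (hd k)
      rw [this]
      exact MeasurableSet.biInter hs fun k _ =>
        measurableSet_le ((h k).dist measurable_const) measurable_const
  have hball : ∀ (g : C(K, F)) (r : ℝ), MeasurableSet (Φ ⁻¹' Metric.ball g r) := by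
    intro g r
    have : Φ ⁻¹' Metric.ball g r = ⋃ n : ℕ, {w | dist (Φ w) g ≤ r - 1 / ((n : ℝ) + 1)} := by
      ext w
      simp only [Set.mem_preimage, Metric.mem_ball, Set.mem_iUnion, Set.mem_ofPred_eq]
      constructor
      · intro hw
        obtain ⟨n, hn⟩ := exists_nat_one_div_lt (sub_pos.2 hw)
        exact ⟨n, by linarith⟩
      · rintro ⟨n, hn⟩
        have : (0 : ℝ) < 1 / ((n : ℝ) + 1) := by positivity
        linarith
    rw [this]
    exact MeasurableSet.iUnion fun n => hclosed _ _
  refine measurable_of_isOpen fun U hU => ?_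
  obtain ⟨T, hTc, hT⟩ := TopologicalSpace.isOpen_iUnion_countable
    (fun i : {gr : C(K, F) × ℝ // Metric.ball gr.1 gr.2 ⊆ U} => Metric.ball i.1.1 i.1.2)
    fun i => Metric.isOpen_ball
  have hUeq : U = ⋃ i ∈ T, Metric.ball i.1.1 i.1.2 := by
    rw [hT]
    refine Set.Subset.antisymm (fun g hg => ?_) (Set.iUnion_subset fun i => i.2)
    obtain ⟨r, hr, hrU⟩ := Metric.isOpen_iff.1 hU g hg
    exact Set.mem_iUnion.2 ⟨⟨(g, r), hrU⟩, Metric.mem_ball_self hr⟩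
  rw [hUeq, Set.preimage_iUnion₂]
  exact MeasurableSet.biUnion hTc fun i _ => hball _ _

/-- The strong law of large numbers in the Banach space `C(K, F)`. -/
theorem uniform_strong_law {Ω 𝒲 K F : Type*} [MeasurableSpace Ω] [MeasurableSpace 𝒲]
    {P : Measure Ω} [IsProbabilityMeasure P]
    [TopologicalSpace K] [CompactSpace K] [T2Space K] [SecondCountableTopology K]
    [NormedAddCommGroup F] [NormedSpace ℝ F] [CompleteSpace F] [SecondCountableTopology F]
    [MeasurableSpace F] [BorelSpace F]
    {W : ℕ → Ω → 𝒲} (hind : iIndepFun W P) (hid : ∀ i, IdentDistrib (W i) (W 0) P P)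
    {g : 𝒲 → K → F} (hc : ∀ w, Continuous (g w)) (hm : ∀ k, Measurable fun w => g w k)
    {C : ℝ} (hC : ∀ w k, ‖g w k‖ ≤ C) :
    Continuous (fun k => ∫ ω, g (W 0 ω) k ∂P) ∧
    ∀ᵐ ω ∂P, TendstoUniformly
      (fun (n : ℕ) k => (n : ℝ)⁻¹ • ∑ i ∈ Finset.range n, g (W i ω) k)
      (fun k => ∫ ω, g (W 0 ω) k ∂P) atTop := by
  borelize C(K, F)
  let Φ : 𝒲 → C(K, F) := fun w => ⟨g w, hc w⟩
  have hΦ : Measurable Φ := ContinuousMap.measurable_of_eval hm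
  have hint : Integrable (fun ω => Φ (W 0 ω)) P := by
    refine Integrable.of_bound (hΦ.comp_aemeasurable (hid 0).aemeasurable_fst).aestronglyMeasurable
      (max C 0) (ae_of_all _ fun ω => ?_)
    rw [ContinuousMap.norm_le _ (le_max_right _ _)]
    exact fun k => (hC _ k).trans (le_max_left _ _)
  have heval : ∀ k, (∫ ω, Φ (W 0 ω) ∂P) k = ∫ ω, g (W 0 ω) k ∂P := fun k =>
    ((ContinuousMap.evalCLM ℝ k).integral_comp_comm hint).symm
  have hsl := strong_law_ae (μ := P) (fun i ω => Φ (W i ω)) hint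
    (fun i j hij => (hind.indepFun hij).comp hΦ hΦ) fun i => (hid i).comp hΦ
  refine ⟨?_, ?_⟩
  · have := (∫ ω, Φ (W 0 ω) ∂P).continuous
    rwa [show (⇑(∫ ω, Φ (W 0 ω) ∂P)) = fun k => ∫ ω, g (W 0 ω) k ∂P from funext heval] at this
  · filter_upwards [hsl] with ω hω
    have := ContinuousMap.tendsto_iff_tendstoUniformly.1 hω
    rw [show (⇑(∫ ω, Φ (W 0 ω) ∂P)) = fun k => ∫ ω, g (W 0 ω) k ∂P from funext heval] at this
    convert! this using 3 with n k
    simp [Φ]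

/-! ### Measurability of differentials with respect to a parameter -/

/-- In finite dimension a linear map is a fixed continuous function of its values on a basis. -/
theorem measurable_continuousLinearMap_of_apply {𝒲 V G : Type*} [MeasurableSpace 𝒲]
    [NormedAddCommGroup V] [NormedSpace ℝ V] [FiniteDimensional ℝ V]
    [NormedAddCommGroup G] [NormedSpace ℝ G] [FiniteDimensional ℝ G]
    [MeasurableSpace G] [BorelSpace G]
    {A : 𝒲 → V →L[ℝ] G} (h : ∀ v, Measurable fun w => A w v) : Measurable A := by
  let b := Module.finBasis ℝ V
  have hA : A = fun w => ∑ i, ((b.coord i).toContinuousLinearMap).smulRight (A w (b i)) := by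
    funext w
    ext v
    have := congrArg (A w) (b.sum_repr v)
    rw [map_sum] at this
    simpa using this.symm
  rw [hA]
  have hcont : ∀ i, Continuous fun y : G => ((b.coord i).toContinuousLinearMap).smulRight y :=
    fun i => (ContinuousLinearMap.smulRightL ℝ V G (b.coord i).toContinuousLinearMap).continuous
  exact Finset.measurable_sum _ fun i _ => (hcont i).measurable.comp (h _)

/-- The derivative at a point of a family of functions that depends measurably on a parameter is
measurable in the parameter, as a limit of difference quotients. -/
theorem measurable_fderiv_param {𝒲 V G : Type*} [MeasurableSpace 𝒲]
    [NormedAddCommGroup V] [NormedSpace ℝ V] [FiniteDimensional ℝ V]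
    [NormedAddCommGroup G] [NormedSpace ℝ G] [FiniteDimensional ℝ G]
    [MeasurableSpace G] [BorelSpace G]
    {f : 𝒲 → V → G} {s : Set V} (hs : IsOpen s) (hm : ∀ t ∈ s, Measurable fun w => f w t)
    {t : V} (ht : t ∈ s) (hf : ∀ w, DifferentiableAt ℝ (f w) t) :
    Measurable fun w => fderiv ℝ (f w) t := by
  refine measurable_continuousLinearMap_of_apply fun v => ?_
  have hlim : Tendsto (fun n : ℕ => t + ((n : ℝ))⁻¹ • v) atTop (𝓝 t) := by
    have : Tendsto (fun n : ℕ => ((n : ℝ))⁻¹) atTop (𝓝 0) := tendsto_inv_atTop_nhds_zero_nat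
    simpa using tendsto_const_nhds.add (this.smul_const v)
  obtain ⟨N, hN⟩ := eventually_atTop.1 (hlim (hs.mem_nhds ht))
  refine measurable_of_tendsto_metrizable
    (f := fun (n : ℕ) w => ((n + N : ℕ) : ℝ) • (f w (t + (((n + N : ℕ) : ℝ))⁻¹ • v) - f w t))
    (fun n => ((hm _ (hN _ (Nat.le_add_left _ _))).sub (hm t ht)).const_smul _) ?_
  refine tendsto_pi_nhds.2 fun w => ?_
  exact ((hf w).hasFDerivAt.lim_real v).comp
    (tendsto_natCast_atTop_atTop.comp (tendsto_add_atTop_nat N))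

/-! ### The multivariate central limit theorem -/

section CLT

variable {Ω : Type*} [MeasurableSpace Ω] {P : Measure Ω}

theorem covMat_congr_ae {m : ℕ} {W W' : Ω → Euc m} (h : W =ᵐ[P] W') :
    covMat P W = covMat P W' := by
  have hi : ∀ i, (fun ω => W ω i) =ᵐ[P] fun ω => W' ω i := fun i => h.mono fun ω hω =>
    congrArg (fun x : Euc m => x i) hω
  ext i j
  simp only [covMat, covariance, Matrix.of_apply, integral_congr_ae (hi i),
    integral_congr_ae (hi j)]
  exact integral_congr_ae (by filter_upwards [h] with ω hω using by rw [hω])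

theorem variance_inner_eq [IsFiniteMeasure P] {m : ℕ} {W : Ω → Euc m} (hW : MemLp W 2 P)
    (t : Euc m) :
    variance (fun ω => inner ℝ (W ω) t) P = t.ofLp ⬝ᵥ covMat P W *ᵥ t.ofLp := by
  have hWi : ∀ i, MemLp (fun ω => W ω i) 2 P := fun i =>
    (EuclideanSpace.proj (𝕜 := ℝ) i).comp_memLp' hW
  have h1 : (fun ω => inner ℝ (W ω) t) = fun ω => ∑ i, t i * W ω i := by
    funext ω
    simp [PiLp.inner_apply]
  rw [h1, variance_fun_sum fun i => (hWi i).const_mul (t i)]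
  simp only [dotProduct, mulVec, covMat, Matrix.of_apply, Finset.mul_sum]
  refine Finset.sum_congr rfl fun i _ => Finset.sum_congr rfl fun j _ => ?_
  rw [covariance_const_mul_left, covariance_const_mul_right]
  ring

theorem posSemidef_covMat [IsFiniteMeasure P] {m : ℕ} {W : Ω → Euc m} (hW : MemLp W 2 P) :
    (covMat P W).PosSemidef := by
  refine Matrix.PosSemidef.of_dotProduct_mulVec_nonneg ?_ fun x => ?_
  · ext i j
    simp [covMat, covariance_comm]
  · have := variance_inner_eq hW (WithLp.toLp 2 x)
    simp only [star_trivial]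
    rw [← this]
    exact variance_nonneg _ _

variable [IsProbabilityMeasure P]

/-- The Cramér–Wold device reduces the convergence of characteristic functions to the central
limit theorem in dimension one. -/
theorem tendstoInDistribution_sum_multivariateGaussian {m : ℕ} {W : ℕ → Ω → Euc m}
    (hW : MemLp (W 0) 2 P) (h0 : ∫ ω, W 0 ω ∂P = 0) (hind : iIndepFun W P)
    (hid : ∀ i, IdentDistrib (W i) (W 0) P P) :
    TendstoInDistribution (fun (n : ℕ) ω => (√n)⁻¹ • ∑ i ∈ Finset.range n, W i ω) atTop
      id (fun _ => P) (multivariateGaussian 0 (covMat P (W 0))) where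
  forall_aemeasurable n :=
    (Finset.aemeasurable_fun_sum _ fun i _ => (hid i).aemeasurable_fst).fun_const_smul _
  aemeasurable_limit := aemeasurable_id
  tendsto := by
    have hmW : ∀ n : ℕ, AEMeasurable (fun ω => (√n)⁻¹ • ∑ i ∈ Finset.range n, W i ω) P := fun n =>
      (Finset.aemeasurable_fun_sum _ fun i _ => (hid i).aemeasurable_fst).fun_const_smul _
    refine ProbabilityMeasure.tendsto_iff_tendsto_charFun.2 fun t => ?_
    have hmeas : Measurable fun x : Euc m => inner ℝ x t := by fun_prop
    have hint0 : ∫ ω, inner ℝ (W 0 ω) t ∂P = 0 := by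
      simp_rw [fun ω => real_inner_comm t (W 0 ω)]
      rw [integral_inner (𝕜 := ℝ) (hW.integrable (by norm_num)) t, h0, inner_zero_right]
    have hclt := (tendstoInDistribution_inv_sqrt_mul_sum_sub
      (X := fun i ω => inner ℝ (W i ω) t) (P := P) (Y := id)
      (P' := gaussianReal 0 (variance (fun ω => inner ℝ (W 0 ω) t) P).toNNReal)
      ⟨aemeasurable_id, Measure.map_id⟩ (hW.inner_const t)
      (hind.comp (fun _ x => inner ℝ x t) fun _ => hmeas) fun i => (hid i).comp hmeas).tendsto
    have h1 := ProbabilityMeasure.tendsto_iff_tendsto_charFun.1 hclt 1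
    simp only [hint0, mul_zero, sub_zero, ProbabilityMeasure.coe_mk, Measure.map_id] at h1
    simp only [ProbabilityMeasure.coe_mk, Measure.map_id]
    rw [charFun_gaussianReal] at h1
    rw [charFun_multivariateGaussian (posSemidef_covMat hW), ← variance_inner_eq hW]
    convert! h1 using 2
    · rename_i n
      rw [charFun_apply, charFun_apply, integral_map (hmW n) (by fun_prop), integral_map _
        (by fun_prop)]
      · simp [inner_smul_left, sum_inner]
      · exact (Finset.aemeasurable_fun_sum _ fun i _ =>
          hmeas.comp_aemeasurable (hid i).aemeasurable_fst).const_mul _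
    · simp [Real.coe_toNNReal _ (variance_nonneg _ _)]

theorem TendstoInDistribution.of_map_eq {Ω' Ω'' E : Type*} [MeasurableSpace Ω']
    [MeasurableSpace Ω''] [TopologicalSpace E] [MeasurableSpace E] [OpensMeasurableSpace E]
    {P' : Measure Ω'} [IsProbabilityMeasure P'] {P'' : Measure Ω''} [IsProbabilityMeasure P'']
    {Y : ℕ → Ω → E} {Z : Ω' → E} {Z' : Ω'' → E}
    (h : TendstoInDistribution Y atTop Z (fun _ => P) P') (hZ : AEMeasurable Z' P'')
    (hmap : P'.map Z = P''.map Z') : TendstoInDistribution Y atTop Z' (fun _ => P) P'' where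
  forall_aemeasurable := h.forall_aemeasurable
  aemeasurable_limit := hZ
  tendsto := by
    have := h.tendsto
    simp only [hmap] at this
    exact this

/-- Asymptotic normality from an asymptotic linear expansion: if `S n` denotes the normalized sums
of centered bounded i.i.d. random vectors `ξ i` and `Y n = B (S n) + o(‖S n‖)` almost surely, then
`Y n` is asymptotically Gaussian with the covariance of `B (ξ 0)`. -/
theorem tendstoInDistribution_of_linear_expansion {G : Type*} [NormedAddCommGroup G]
    [NormedSpace ℝ G] [FiniteDimensional ℝ G] [MeasurableSpace G] [BorelSpace G] {m : ℕ}
    {ξ : ℕ → Ω → G} {C : ℝ} (hC : ∀ᵐ ω ∂P, ‖ξ 0 ω‖ ≤ C) (h0 : ∫ ω, ξ 0 ω ∂P = 0)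
    (hind : iIndepFun ξ P) (hid : ∀ i, IdentDistrib (ξ i) (ξ 0) P P) (B : G →L[ℝ] Euc m)
    {Y : ℕ → Ω → Euc m} (hY : ∀ n, AEMeasurable (Y n) P)
    (hexp : ∀ᵐ ω ∂P, ∀ ε > 0, ∀ᶠ n : ℕ in atTop,
      ‖Y n ω - B ((√n)⁻¹ • ∑ i ∈ Finset.range n, ξ i ω)‖ ≤
        ε * ‖(√n)⁻¹ • ∑ i ∈ Finset.range n, ξ i ω‖) :
    TendstoInDistribution Y atTop id (fun _ => P)
      (multivariateGaussian 0 (covMat P fun ω => B (ξ 0 ω))) := by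
  set S : ℕ → Ω → G := fun n ω => (√n)⁻¹ • ∑ i ∈ Finset.range n, ξ i ω with hS
  have hSm : ∀ n, AEMeasurable (S n) P := fun n =>
    (Finset.aemeasurable_fun_sum _ fun i _ => (hid i).aemeasurable_fst).const_smul _
  have hmem : MemLp (ξ 0) 2 P :=
    MemLp.of_bound (hid 0).aemeasurable_fst.aestronglyMeasurable C hC
  have clt : ∀ {k : ℕ} (A : G →L[ℝ] Euc k), TendstoInDistribution (fun n ω => A (S n ω)) atTop
      id (fun _ => P) (multivariateGaussian 0 (covMat P fun ω => A (ξ 0 ω))) := by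
    intro k A
    have := tendstoInDistribution_sum_multivariateGaussian (P := P) (W := fun i ω => A (ξ i ω))
      (A.comp_memLp' hmem)
      (by rw [A.integral_comp_comm (hmem.integrable (by norm_num)), h0, map_zero])
      (hind.comp (fun _ => A) fun _ => A.measurable) fun i => (hid i).comp A.measurable
    simpa [hS] using this
  let e : G ≃L[ℝ] Euc (Module.finrank ℝ G) :=
    ContinuousLinearEquiv.ofFinrankEq (by simp)
  have hSd := (clt (e : G →L[ℝ] Euc (Module.finrank ℝ G))).continuous_comp e.symm.continuous
  have hSd' : TendstoInDistribution S atTop (e.symm ∘ id) (fun _ => P)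
      (multivariateGaussian 0 (covMat P fun ω => (e : G →L[ℝ] Euc (Module.finrank ℝ G)) (ξ 0 ω))) :=
    by
    refine hSd.congr (fun n => ae_of_all _ fun ω => ?_) EventuallyEq.rfl
    simp
  -- the relative remainder; `1 +` avoids a division by zero when `S n ω = 0`
  let r : ℕ → Ω → Euc m := fun n ω => (1 + ‖S n ω‖)⁻¹ • (Y n ω - B (S n ω))
  have hrm : ∀ n, AEMeasurable (r n) P := fun n =>
    (((hSm n).norm.const_add 1).inv).smul ((hY n).sub (B.measurable.comp_aemeasurable (hSm n)))
  have hr : TendstoInMeasure P r atTop fun _ => 0 := by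
    refine tendstoInMeasure_of_tendsto_ae (fun n => (hrm n).aestronglyMeasurable) ?_
    filter_upwards [hexp] with ω hω
    rw [Metric.tendsto_nhds]
    intro ε hε
    filter_upwards [hω (ε / 2) (half_pos hε)] with n hn
    have hpos : 0 < 1 + ‖S n ω‖ := by positivity
    rw [dist_zero_right, norm_smul, norm_inv, Real.norm_of_nonneg hpos.le, inv_mul_lt_iff₀ hpos]
    nlinarith [norm_nonneg (S n ω)]
  have hg : Continuous fun u : G × Euc m => B u.1 + (1 + ‖u.1‖) • u.2 := by fun_prop
  have key := hSd'.continuous_comp_prodMk_of_tendstoInMeasure_const hg hr hrm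
  have hYd : TendstoInDistribution Y atTop (fun x => B (e.symm x)) (fun _ => P)
      (multivariateGaussian 0
        (covMat P fun ω => (e : G →L[ℝ] Euc (Module.finrank ℝ G)) (ξ 0 ω))) := by
    refine key.congr (fun n => ae_of_all _ fun ω => ?_) (ae_of_all _ fun x => by simp)
    have hpos : 1 + ‖S n ω‖ ≠ 0 := by positivity
    simp [r, smul_smul, mul_inv_cancel₀ hpos]
  refine TendstoInDistribution.of_map_eq hYd aemeasurable_id ?_
  -- both laws are limits of the law of `B (S n)`
  exact tendstoInDistribution_unique _ (hSd'.continuous_comp B.continuous) (clt B)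

end CLT

/-! ### Stability of minimax points -/

/-- `θ` minimizes `sup_{α ∈ Λ} F (·, α)` over `Θ`, in a form that does not mention the supremum and
is equivalent when the maxima over `Λ` are attained. -/
def IsMinimaxOn {T A : Type*} (Θ : Set T) (Λ : Set A) (F : T × A → ℝ) (θ : T) : Prop :=
  θ ∈ Θ ∧ ∀ θ' ∈ Θ, ∃ β ∈ Λ, ∀ α ∈ Λ, F (θ, α) ≤ F (θ', β)

section Consistency

variable {ι T A : Type*} [TopologicalSpace T] [TopologicalSpace A] {l : Filter ι}
  {Θ : Set T} {Λ : Set A} {F : ι → T × A → ℝ} {L : T × A → ℝ}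

theorem ContinuousOn.exists_argmax {F : T × A → ℝ} (hF : ContinuousOn F (Θ ×ˢ Λ))
    (hΛ : IsCompact Λ) (hne : Λ.Nonempty) {θ : T} (hθ : θ ∈ Θ) :
    ∃ α ∈ Λ, ∀ β ∈ Λ, F (θ, β) ≤ F (θ, α) :=
  hΛ.exists_isMaxOn hne (hF.comp (by fun_prop) fun _ hα => ⟨hθ, hα⟩)

theorem TendstoUniformlyOn.tendsto_apply_prod (hu : TendstoUniformlyOn F L l (Θ ×ˢ Λ))
    (hL : ContinuousOn L (Θ ×ˢ Λ)) {θ : ι → T} {α : ι → A} {θ₀ : T} {α₀ : A}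
    (hθ : Tendsto θ l (𝓝 θ₀)) (hθΘ : ∀ᶠ i in l, θ i ∈ Θ) (hθ₀ : θ₀ ∈ Θ)
    (hα : Tendsto α l (𝓝 α₀)) (hαΛ : ∀ᶠ i in l, α i ∈ Λ) (hα₀ : α₀ ∈ Λ) :
    Tendsto (fun i => F i (θ i, α i)) l (𝓝 (L (θ₀, α₀))) := by
  refine hu.tendsto_comp (g := fun i => (θ i, α i)) (hL _ ⟨hθ₀, hα₀⟩) ?_
  refine tendsto_nhdsWithin_iff.2 ⟨hθ.prodMk_nhds hα, ?_⟩
  filter_upwards [hθΘ, hαΛ] with i h1 h2 using ⟨h1, h2⟩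

/-- Maximizers of `F i (θ i, ·)` converge to the unique maximizer of `L (θ₀, ·)`. -/
theorem tendsto_of_forall_isMax (hΛ : IsCompact Λ) (hu : TendstoUniformlyOn F L l (Θ ×ˢ Λ))
    (hL : ContinuousOn L (Θ ×ˢ Λ)) {θ : ι → T} {α : ι → A} {θ₀ : T} {α₀ : A}
    (hθ : Tendsto θ l (𝓝 θ₀)) (hθΘ : ∀ᶠ i in l, θ i ∈ Θ) (hθ₀ : θ₀ ∈ Θ)
    (hα : ∀ᶠ i in l, α i ∈ Λ ∧ ∀ β ∈ Λ, F i (θ i, β) ≤ F i (θ i, α i))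
    (huniq : ∀ α' ∈ Λ, (∀ β ∈ Λ, L (θ₀, β) ≤ L (θ₀, α')) → α' = α₀) :
    Tendsto α l (𝓝 α₀) := by
  refine hΛ.tendsto_nhds_of_unique_mapClusterPt (hα.mono fun i h => h.1) fun α' hα' hcl => ?_
  obtain ⟨u, hul, hu'⟩ := mapClusterPt_iff_ultrafilter.1 hcl
  refine huniq α' hα' fun β hβ => ?_
  have huu : TendstoUniformlyOn F L u (Θ ×ˢ Λ) := fun s hs => (hu s hs).filter_mono hul
  refine le_of_tendsto_of_tendsto
    (huu.tendsto_apply_prod hL (hθ.mono_left hul) (hθΘ.filter_mono hul) hθ₀ tendsto_const_nhds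
      (Eventually.of_forall fun _ => hβ) hβ)
    (huu.tendsto_apply_prod hL (hθ.mono_left hul) (hθΘ.filter_mono hul) hθ₀ hu'
      ((hα.filter_mono hul).mono fun i h => h.1) hα') ?_
  filter_upwards [hα.filter_mono hul] with i hi using hi.2 β hβ

/-- Minimax points of `F i` converge to the unique minimax point of `L`. -/
theorem tendsto_of_isMinimaxOn (hΘ : IsCompact Θ) (hΛ : IsCompact Λ)
    (hu : TendstoUniformlyOn F L l (Θ ×ˢ Λ)) (hL : ContinuousOn L (Θ ×ˢ Λ)) {θ : ι → T} {θ₀ : T}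
    (hθ : ∀ᶠ i in l, IsMinimaxOn Θ Λ (F i) (θ i))
    (huniq : ∀ θ', IsMinimaxOn Θ Λ L θ' → θ' = θ₀) : Tendsto θ l (𝓝 θ₀) := by
  refine hΘ.tendsto_nhds_of_unique_mapClusterPt (hθ.mono fun i h => h.1) fun θ₁ hθ₁ hcl => ?_
  obtain ⟨u, hul, hu'⟩ := mapClusterPt_iff_ultrafilter.1 hcl
  refine huniq θ₁ ⟨hθ₁, fun θ' hθ' => ?_⟩
  have huu : TendstoUniformlyOn F L u (Θ ×ˢ Λ) := fun s hs => (hu s hs).filter_mono hul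
  have hev := hθ.filter_mono hul
  have hβ : ∀ i, ∃ β, IsMinimaxOn Θ Λ (F i) (θ i) →
      β ∈ Λ ∧ ∀ α ∈ Λ, F i (θ i, α) ≤ F i (θ', β) := by
    intro i
    by_cases hi : IsMinimaxOn Θ Λ (F i) (θ i)
    · obtain ⟨β, h1, h2⟩ := hi.2 θ' hθ'
      exact ⟨β, fun _ => ⟨h1, h2⟩⟩
    · obtain ⟨j, hj⟩ := hev.exists
      exact ⟨(hj.2 θ' hθ').choose, fun h => absurd h hi⟩
  choose β hβ using hβ
  have hβΛ : ∀ᶠ i in (u : Filter ι), β i ∈ Λ := hev.mono fun i hi => (hβ i hi).1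
  obtain ⟨β₁, hβ₁, hlim⟩ := hΛ.ultrafilter_le_nhds (u.map β) (le_principal_iff.2 hβΛ)
  refine ⟨β₁, hβ₁, fun α hα => ?_⟩
  refine le_of_tendsto_of_tendsto
    (huu.tendsto_apply_prod hL hu' (hev.mono fun i h => h.1) hθ₁ tendsto_const_nhds
      (Eventually.of_forall fun _ => hα) hα)
    (huu.tendsto_apply_prod hL tendsto_const_nhds (Eventually.of_forall fun _ => hθ') hθ'
      hlim hβΛ hβ₁) ?_
  filter_upwards [hev] with i hi using (hβ i hi).2 α hα

end Consistency

/-! ### First order conditions and linearization at minimax points -/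

section FirstOrder

variable {E₁ E₂ : Type*} [NormedAddCommGroup E₁] [NormedSpace ℝ E₁]
  [NormedAddCommGroup E₂] [NormedSpace ℝ E₂] {Θ : Set E₁} {Λ : Set E₂}

theorem fderiv_inr_eq_zero_of_isMax {F : E₁ × E₂ → ℝ} {F' : E₁ × E₂ →L[ℝ] ℝ} {θ : E₁} {α : E₂}
    (hα : Λ ∈ 𝓝 α) (hmax : ∀ β ∈ Λ, F (θ, β) ≤ F (θ, α)) (hF : HasFDerivAt F F' (θ, α)) (v : E₂) :
    F' (0, v) = 0 := by
  have h1 : HasFDerivAt (fun β => F (θ, β)) (F'.comp (ContinuousLinearMap.inr ℝ E₁ E₂)) α :=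
    hF.comp α (hasFDerivAt_prodMk_right θ α)
  have h2 : IsLocalMax (fun β => F (θ, β)) α := by
    filter_upwards [hα] with β hβ using hmax β hβ
  simpa using congrArg (fun A => A v) (h2.hasFDerivAt_eq_zero h1)

/-- The envelope principle of Danskin: at a minimax point whose inner maximizer is unique, the
partial differential in the minimized variable vanishes. Strict differentiability gives
`F (θ + s v, β) - F (θ, β) = s F' (v, 0) + o(s)` uniformly in `β` near the maximizer, and the
left-hand side is nonnegative when `β` maximizes `F (θ + s v, ·)`. -/
theorem fderiv_inl_eq_zero_of_isMinimaxOn (hΛ : IsCompact Λ) {F : E₁ × E₂ → ℝ}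
    (hFc : ContinuousOn F (Θ ×ˢ Λ)) {F' : E₁ × E₂ →L[ℝ] ℝ} {θ : E₁} {α : E₂}
    (hθ : Θ ∈ 𝓝 θ) (hmm : IsMinimaxOn Θ Λ F θ) (hαΛ : α ∈ Λ)
    (huniq : ∀ α' ∈ Λ, (∀ β ∈ Λ, F (θ, β) ≤ F (θ, α')) → α' = α)
    (hF : HasStrictFDerivAt F F' (θ, α)) (v : E₁) : F' (v, 0) = 0 := by
  have main : ∀ v : E₁, 0 ≤ F' (v, 0) := by
    intro v
    have hlim : Tendsto (fun s : ℝ => θ + s • v) (𝓝[>] 0) (𝓝 θ) := by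
      have : Tendsto (fun s : ℝ => θ + s • v) (𝓝 0) (𝓝 (θ + (0 : ℝ) • v)) :=
        Continuous.tendsto (by fun_prop) 0
      simpa using this.mono_left nhdsWithin_le_nhds
    have hmem : ∀ᶠ s : ℝ in 𝓝[>] 0, θ + s • v ∈ Θ := hlim hθ
    have hβ : ∀ s : ℝ, ∃ β, θ + s • v ∈ Θ →
        β ∈ Λ ∧ ∀ β' ∈ Λ, F (θ + s • v, β') ≤ F (θ + s • v, β) := by
      intro s
      by_cases hs : θ + s • v ∈ Θ
      · obtain ⟨β, h1, h2⟩ := hFc.exists_argmax hΛ ⟨α, hαΛ⟩ hs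
        exact ⟨β, fun _ => ⟨h1, h2⟩⟩
      · exact ⟨α, fun h => absurd h hs⟩
    choose β hβ using hβ
    have hβlim : Tendsto β (𝓝[>] 0) (𝓝 α) :=
      tendsto_of_forall_isMax (F := fun _ => F) (L := F) hΛ
        (fun s hs => Eventually.of_forall fun _ x _ => refl_mem_uniformity hs) hFc hlim hmem hmm.1
        (hmem.mono fun s hs => hβ s hs) huniq
    have hpair : Tendsto (fun s : ℝ => ((θ + s • v, β s), (θ, β s))) (𝓝[>] 0)
        (𝓝 ((θ, α), (θ, α))) :=
      (hlim.prodMk_nhds hβlim).prodMk_nhds (tendsto_const_nhds.prodMk_nhds hβlim)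
    refine le_of_forall_pos_le_add fun ε hε => ?_
    have hε' : 0 < ε / (‖v‖ + 1) := by positivity
    obtain ⟨s, hs, hsΘ, hspos⟩ := ((hpair.eventually (hF.isLittleO.bound hε')).and
      (hmem.and self_mem_nhdsWithin)).exists
    have hspos' : 0 < s := hspos
    have hdiff : ((θ + s • v, β s) : E₁ × E₂) - (θ, β s) = s • (v, 0) := by simp
    simp only [hdiff, map_smul, smul_eq_mul, norm_smul, Real.norm_of_nonneg hspos'.le] at hs
    have hv : ‖((v, 0) : E₁ × E₂)‖ = ‖v‖ := by simp [Prod.norm_def]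
    rw [hv] at hs
    have h1 : 0 ≤ F (θ + s • v, β s) - F (θ, β s) := by
      obtain ⟨γ, hγ, h⟩ := hmm.2 _ hsΘ
      linarith [h _ (hβ s hsΘ).1, (hβ s hsΘ).2 γ hγ]
    have h2 : ε / (‖v‖ + 1) * (s * ‖v‖) ≤ s * ε := by
      have : ε / (‖v‖ + 1) * ‖v‖ ≤ ε := by
        rw [div_mul_eq_mul_div, div_le_iff₀ (by positivity)]
        nlinarith [norm_nonneg v]
      nlinarith
    have h3 : 0 ≤ s * (F' (v, 0) + ε) := by
      have := (abs_le.1 (Real.norm_eq_abs _ ▸ hs)).2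
      nlinarith
    exact nonneg_of_mul_nonneg_right h3 hspos'
  have hneg := main (-v)
  rw [show ((-v, 0) : E₁ × E₂) = -(v, 0) by simp, map_neg] at hneg
  exact le_antisymm (by linarith) (main v)

/-- Linearization of minimax points. If `F i → L` uniformly and the second differentials of `F i`
are close to a nondegenerate `H` near `t₀ = (θ₀, α₀)`, then minimax points `θ i` of `F i` are first
components of critical points `t₀ + u i` of `F i` and
`H (u i) = -D(F i)(t₀) + o(‖D(F i)(t₀)‖)`. -/
theorem exists_linearization_of_isMinimaxOn {ι : Type*} {l : Filter ι}
    (hΘ : IsCompact Θ) (hΛ : IsCompact Λ) {F : ι → E₁ × E₂ → ℝ} {L : E₁ × E₂ → ℝ}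
    (hu : TendstoUniformlyOn F L l (Θ ×ˢ Λ)) (hL : ContinuousOn L (Θ ×ˢ Λ))
    (hFc : ∀ i, ContinuousOn (F i) (Θ ×ˢ Λ)) {θ₀ : E₁} {α₀ : E₂} {s : Set (E₁ × E₂)}
    (hs : s ∈ 𝓝 (θ₀, α₀)) (hsK : s ⊆ Θ ×ˢ Λ)
    {F' : ι → E₁ × E₂ → E₁ × E₂ →L[ℝ] ℝ} {F'' : ι → E₁ × E₂ → E₁ × E₂ →L[ℝ] E₁ × E₂ →L[ℝ] ℝ}
    (hF' : ∀ i, ∀ t ∈ s, HasFDerivAt (F i) (F' i t) t)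
    (hF'' : ∀ i, ∀ t ∈ s, HasFDerivAt (F' i) (F'' i t) t)
    {H : E₁ × E₂ →L[ℝ] E₁ × E₂ →L[ℝ] ℝ}
    (hH : ∀ ε > 0, ∃ δ > 0, ∀ᶠ i in l, ∀ t ∈ Metric.ball (θ₀, α₀) δ, ‖F'' i t - H‖ ≤ ε)
    {c : ℝ} (hc : 0 < c) (hHc : ∀ u, c * ‖u‖ ≤ ‖H u‖)
    (hH2c : ∀ v, c * ‖v‖ ≤ ‖(H (0, v)).comp (ContinuousLinearMap.inr ℝ E₁ E₂)‖)
    (huniqθ : ∀ θ', IsMinimaxOn Θ Λ L θ' → θ' = θ₀)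
    (huniqα : ∀ α' ∈ Λ, (∀ β ∈ Λ, L (θ₀, β) ≤ L (θ₀, α')) → α' = α₀)
    {θ : ι → E₁} (hθ : ∀ᶠ i in l, IsMinimaxOn Θ Λ (F i) (θ i)) :
    ∃ u : ι → E₁ × E₂, (∀ i, (u i).1 = θ i - θ₀) ∧
      ∀ ε > 0, ∀ᶠ i in l, ‖H (u i) + F' i (θ₀, α₀)‖ ≤ ε * ‖F' i (θ₀, α₀)‖ := by
  classical
  have ht₀ : (θ₀, α₀) ∈ Θ ×ˢ Λ := hsK (mem_of_mem_nhds hs)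
  have hθlim : Tendsto θ l (𝓝 θ₀) := tendsto_of_isMinimaxOn hΘ hΛ hu hL hθ huniqθ
  have hθΘ : ∀ᶠ i in l, θ i ∈ Θ := hθ.mono fun i h => h.1
  have hα : ∀ i, ∃ α, θ i ∈ Θ → α ∈ Λ ∧ ∀ β ∈ Λ, F i (θ i, β) ≤ F i (θ i, α) := by
    intro i
    by_cases hi : θ i ∈ Θ
    · obtain ⟨α, h1, h2⟩ := (hFc i).exists_argmax hΛ ⟨α₀, ht₀.2⟩ hi
      exact ⟨α, fun _ => ⟨h1, h2⟩⟩
    · exact ⟨α₀, fun h => absurd h hi⟩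
  choose α hα using hα
  have hαlim : Tendsto α l (𝓝 α₀) := tendsto_of_forall_isMax hΛ hu hL hθlim hθΘ ht₀.1
    (hθΘ.mono fun i hi => hα i hi) huniqα
  -- all inner maximizers are close to `α₀`, uniformly
  have hnear : ∀ δ > 0, ∀ᶠ i in l, ∀ β ∈ Λ, (∀ γ ∈ Λ, F i (θ i, γ) ≤ F i (θ i, β)) →
      dist β α₀ < δ := by
    intro δ hδ
    -- a selection of maximizers that leaves the ball of radius `δ` whenever possible
    let bad : ι → E₂ → Prop := fun i β =>
      β ∈ Λ ∧ (∀ γ ∈ Λ, F i (θ i, γ) ≤ F i (θ i, β)) ∧ ¬ dist β α₀ < δ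
    let α' : ι → E₂ := fun i => if h : ∃ β, bad i β then h.choose else α i
    have hα'lim : Tendsto α' l (𝓝 α₀) := by
      refine tendsto_of_forall_isMax hΛ hu hL hθlim hθΘ ht₀.1 (hθΘ.mono fun i hi => ?_) huniqα
      by_cases h : ∃ β, bad i β
      · simp only [α', dif_pos h]
        exact ⟨h.choose_spec.1, h.choose_spec.2.1⟩
      · simp only [α', dif_neg h]
        exact hα i hi
    filter_upwards [hα'lim (Metric.ball_mem_nhds α₀ hδ)] with i hi β hβ hβmax
    by_contra hd
    have h : ∃ β, bad i β := ⟨β, hβ, hβmax, hd⟩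
    have hi' : dist (α' i) α₀ < δ := hi
    simp only [α', dif_pos h] at hi'
    exact h.choose_spec.2.2 hi'
  -- the mean value inequality for the first differentials
  have hmv : ∀ ε > 0, ∃ δ > 0, Metric.ball (θ₀, α₀) δ ⊆ s ∧ ∀ᶠ i in l,
      ∀ x ∈ Metric.ball (θ₀, α₀) δ, ∀ y ∈ Metric.ball (θ₀, α₀) δ,
        ‖F' i y - F' i x - H (y - x)‖ ≤ ε * ‖y - x‖ := by
    intro ε hε
    obtain ⟨δ₁, hδ₁, h1⟩ := hH ε hε
    obtain ⟨δ₂, hδ₂, h2⟩ := Metric.mem_nhds_iff.1 hs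
    have hsub : Metric.ball (θ₀, α₀) (min δ₁ δ₂) ⊆ s :=
      (Metric.ball_subset_ball (min_le_right _ _)).trans h2
    refine ⟨min δ₁ δ₂, lt_min hδ₁ hδ₂, hsub, h1.mono fun i hi x hx y hy => ?_⟩
    exact (convex_ball _ _).norm_image_sub_le_of_norm_hasFDerivWithin_le'
      (fun t ht => (hF'' i t (hsub ht)).hasFDerivWithinAt)
      (fun t ht => hi t (Metric.ball_subset_ball (min_le_left _ _) ht)) hx hy
  -- two inner maximizers are both critical in the second variable, so they coincide by `hH2c`, and
  -- the envelope principle applies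
  have hcrit : ∀ᶠ i in l, F' i (θ i, α i) = 0 := by
    obtain ⟨δ, hδ, hδs, hev⟩ := hmv (c / 2) (half_pos hc)
    filter_upwards [hθ, hev, hnear δ hδ, hθlim (Metric.ball_mem_nhds θ₀ hδ)] with i hi hmvi hni hθi
    have hball : ∀ β, dist β α₀ < δ → (θ i, β) ∈ Metric.ball (θ₀, α₀) δ := fun β hβ =>
      max_lt hθi hβ
    have hKn : ∀ β, dist β α₀ < δ → Θ ×ˢ Λ ∈ 𝓝 (θ i, β) := fun β hβ =>
      mem_of_superset (Metric.isOpen_ball.mem_nhds (hball β hβ)) (hδs.trans hsK)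
    have hpart : ∀ β ∈ Λ, (∀ γ ∈ Λ, F i (θ i, γ) ≤ F i (θ i, β)) → ∀ v, F' i (θ i, β) (0, v) = 0 :=
      fun β hβ hmax v => fderiv_inr_eq_zero_of_isMax
        (prod_mem_nhds_iff.1 (hKn β (hni β hβ hmax))).2 hmax
        (hF' i _ (hδs (hball β (hni β hβ hmax)))) v
    obtain ⟨hαi, hαmax⟩ := hα i hi.1
    have huniq : ∀ β ∈ Λ, (∀ γ ∈ Λ, F i (θ i, γ) ≤ F i (θ i, β)) → β = α i := by
      intro β hβ hmax
      have h1 := hmvi _ (hball _ (hni _ hαi hαmax)) _ (hball _ (hni β hβ hmax))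
      have hd : ((θ i, β) : E₁ × E₂) - (θ i, α i) = (0, β - α i) := by simp
      have hn : ‖((0, β - α i) : E₁ × E₂)‖ = ‖β - α i‖ := by simp [Prod.norm_def]
      rw [hd, hn] at h1
      have h2 : (H (0, β - α i)).comp (ContinuousLinearMap.inr ℝ E₁ E₂) =
          -(F' i (θ i, β) - F' i (θ i, α i) - H (0, β - α i)).comp
            (ContinuousLinearMap.inr ℝ E₁ E₂) := by
        ext v
        simp [hpart β hβ hmax v, hpart _ hαi hαmax v]
      have h3 : ‖(H (0, β - α i)).comp (ContinuousLinearMap.inr ℝ E₁ E₂)‖ ≤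
          c / 2 * ‖β - α i‖ := by
        rw [h2, norm_neg]
        refine (ContinuousLinearMap.opNorm_comp_le _ _).trans ?_
        refine (mul_le_of_le_one_right (norm_nonneg _)
          (ContinuousLinearMap.norm_inr_le_one ℝ E₁ E₂)).trans h1
      have h4 := hH2c (β - α i)
      have h5 : ‖β - α i‖ ≤ 0 := by nlinarith [norm_nonneg (β - α i)]
      exact sub_eq_zero.1 (norm_le_zero_iff.1 h5)
    have hmem := hball _ (hni _ hαi hαmax)
    have hstrict : HasStrictFDerivAt (F i) (F' i (θ i, α i)) (θ i, α i) := by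
      refine hasStrictFDerivAt_of_hasFDerivAt_of_continuousAt ?_ (hF'' i _ (hδs hmem)).continuousAt
      filter_upwards [Metric.isOpen_ball.mem_nhds hmem] with t ht using hF' i t (hδs ht)
    ext v
    · simpa using fderiv_inl_eq_zero_of_isMinimaxOn hΛ (hFc i)
        (prod_mem_nhds_iff.1 (hKn _ (hni _ hαi hαmax))).1 hi hαi huniq hstrict v
    · simpa using hpart _ hαi hαmax v
  refine ⟨fun i => (θ i, α i) - (θ₀, α₀), fun i => rfl, fun ε hε => ?_⟩
  obtain ⟨δ, hδ, hδs, hev⟩ := hmv (min (c / 2) (ε * (c / 2))) (by positivity)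
  filter_upwards [hev, hcrit, (hθlim.prodMk_nhds hαlim) (Metric.ball_mem_nhds _ hδ)] with i h1 h2 h3
  have h4 := h1 _ (Metric.mem_ball_self hδ) _ h3
  set u := (θ i, α i) - (θ₀, α₀)
  set g := F' i (θ₀, α₀)
  have h5 : ‖H u + g‖ ≤ min (c / 2) (ε * (c / 2)) * ‖u‖ := by
    rw [h2, zero_sub, ← neg_add', norm_neg, add_comm] at h4
    exact h4
  have h6 : ‖H u‖ ≤ ‖H u + g‖ + ‖g‖ := by
    simpa using norm_sub_le (H u + g) g
  have h7 : c / 2 * ‖u‖ ≤ ‖g‖ := by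
    have := mul_le_mul_of_nonneg_right (min_le_left (c / 2) (ε * (c / 2))) (norm_nonneg u)
    linarith [hHc u]
  calc ‖H u + g‖ ≤ ε * (c / 2) * ‖u‖ :=
        h5.trans (mul_le_mul_of_nonneg_right (min_le_right _ _) (norm_nonneg u))
    _ = ε * (c / 2 * ‖u‖) := by ring
    _ ≤ ε * ‖g‖ := by gcongr

end FirstOrder

/-! ### Gradients, Jacobian matrices and Hessian matrices -/

section Matrices

variable {p q : ℕ}

/-- The vector of coordinates of a linear form, i.e. the vector that represents it through the
inner product, as a continuous linear function of the form. -/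
noncomputable def coordVec (k : ℕ) : (Euc k →L[ℝ] ℝ) →L[ℝ] Euc k :=
  (EuclideanSpace.equiv (Fin k) ℝ).symm.toContinuousLinearMap.comp
    (ContinuousLinearMap.pi fun i => ContinuousLinearMap.apply ℝ ℝ (EuclideanSpace.single i 1))

theorem inner_coordVec {k : ℕ} (φ : Euc k →L[ℝ] ℝ) (v : Euc k) :
    inner ℝ (coordVec k φ) v = φ v := by
  have h := congrArg φ ((EuclideanSpace.basisFun (Fin k) ℝ).sum_repr v)
  rw [map_sum] at h
  rw [← h]
  simp [PiLp.inner_apply, coordVec]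

theorem coordVec_injective (k : ℕ) : Function.Injective (coordVec k) := fun φ ψ h => by
  ext v
  rw [← inner_coordVec, h, inner_coordVec]

theorem HasFDerivAt.gradient_eq_coordVec {k : ℕ} {F : Euc k → ℝ} {φ : Euc k →L[ℝ] ℝ} {x : Euc k}
    (h : HasFDerivAt F φ x) : gradient F x = coordVec k φ := by
  refine ext_inner_right ℝ fun v => ?_
  rw [inner_coordVec, gradient, InnerProductSpace.toDual_symm_apply, h.fderiv]

theorem HasFDerivAt.jacobian_mulVec {m k : ℕ} {g : Euc m → Euc k} {g' : Euc m →L[ℝ] Euc k}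
    {t : Euc m} (h : HasFDerivAt g g' t) (v : Euc m) : jacobian g t *ᵥ v.ofLp = (g' v).ofLp := by
  have hv := congrArg g' ((EuclideanSpace.basisFun (Fin m) ℝ).sum_repr v)
  rw [map_sum] at hv
  rw [← hv]
  funext i
  simp [mulVec, dotProduct, jacobian, h.fderiv, mul_comm]

theorem Filter.Eventually.hessian_mulVec {k : ℕ} {F : Euc k → ℝ} {F' : Euc k → Euc k →L[ℝ] ℝ}
    {F'' : Euc k →L[ℝ] Euc k →L[ℝ] ℝ} {x : Euc k} (h : ∀ᶠ y in 𝓝 x, HasFDerivAt F (F' y) y)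
    (h' : HasFDerivAt F' F'' x) (v : Euc k) :
    hessian F x *ᵥ v.ofLp = (coordVec k (F'' v)).ofLp := by
  have h1 : HasFDerivAt (gradient F) ((coordVec k).comp F'') x :=
    ((coordVec k).hasFDerivAt.comp x h').congr_of_eventuallyEq
      (h.mono fun y hy => hy.gradient_eq_coordVec)
  exact h1.jacobian_mulVec v

/-- The vector of partial derivatives in the first variable of a linear form on a product. -/
noncomputable def coordFst (p q : ℕ) : (Euc p × Euc q →L[ℝ] ℝ) →L[ℝ] Euc p :=
  (coordVec p).comp
    ((ContinuousLinearMap.compL ℝ (Euc p) (Euc p × Euc q) ℝ).flip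
      (ContinuousLinearMap.inl ℝ (Euc p) (Euc q)))

/-- The vector of partial derivatives in the second variable of a linear form on a product. -/
noncomputable def coordSnd (p q : ℕ) : (Euc p × Euc q →L[ℝ] ℝ) →L[ℝ] Euc q :=
  (coordVec q).comp
    ((ContinuousLinearMap.compL ℝ (Euc q) (Euc p × Euc q) ℝ).flip
      (ContinuousLinearMap.inr ℝ (Euc p) (Euc q)))

theorem coordSnd_apply (φ : Euc p × Euc q →L[ℝ] ℝ) :
    coordSnd p q φ = coordVec q (φ.comp (ContinuousLinearMap.inr ℝ (Euc p) (Euc q))) := rfl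

theorem coordSnd_eq_zero_iff {φ : Euc p × Euc q →L[ℝ] ℝ} :
    coordSnd p q φ = 0 ↔ φ.comp (ContinuousLinearMap.inr ℝ (Euc p) (Euc q)) = 0 := by
  rw [coordSnd_apply, map_eq_zero_iff _ (coordVec_injective q)]

theorem HasFDerivAt.gradient_fst {F : Euc p × Euc q → ℝ} {φ : Euc p × Euc q →L[ℝ] ℝ}
    {θ : Euc p} {α : Euc q} (h : HasFDerivAt F φ (θ, α)) :
    gradient (fun θ' => F (θ', α)) θ = coordFst p q φ :=
  HasFDerivAt.gradient_eq_coordVec (h.comp θ (hasFDerivAt_prodMk_left θ α))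

theorem HasFDerivAt.gradient_snd {F : Euc p × Euc q → ℝ} {φ : Euc p × Euc q →L[ℝ] ℝ}
    {θ : Euc p} {α : Euc q} (h : HasFDerivAt F φ (θ, α)) :
    gradient (fun α' => F (θ, α')) α = coordSnd p q φ :=
  HasFDerivAt.gradient_eq_coordVec (h.comp α (hasFDerivAt_prodMk_right θ α))

end Matrices

/-! ### Second order analysis of the value function -/

section ValueFunction

variable {p q : ℕ} {L : Euc p × Euc q → ℝ} {L' : Euc p × Euc q → Euc p × Euc q →L[ℝ] ℝ}
  {H : Euc p × Euc q →L[ℝ] Euc p × Euc q →L[ℝ] ℝ} {θ₀ : Euc p} {α₀ : Euc q}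

theorem hessian_snd_mulVec (hL : ∀ᶠ t in 𝓝 (θ₀, α₀), HasFDerivAt L (L' t) t)
    (hL' : HasFDerivAt L' H (θ₀, α₀)) (w : Euc q) :
    hessian (fun α => L (θ₀, α)) α₀ *ᵥ w.ofLp = (coordSnd p q (H (0, w))).ofLp := by
  have hc : Tendsto (fun α : Euc q => (θ₀, α)) (𝓝 α₀) (𝓝 (θ₀, α₀)) := by
    exact Continuous.tendsto (by fun_prop) α₀
  have h1 : ∀ᶠ α in 𝓝 α₀, HasFDerivAt (fun α => L (θ₀, α))
      ((L' (θ₀, α)).comp (ContinuousLinearMap.inr ℝ (Euc p) (Euc q))) α :=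
    (hc.eventually hL).mono fun α hα => hα.comp α (hasFDerivAt_prodMk_right θ₀ α)
  have h2 := ((ContinuousLinearMap.compL ℝ (Euc q) (Euc p × Euc q) ℝ).flip
      (ContinuousLinearMap.inr ℝ (Euc p) (Euc q))).hasFDerivAt.comp α₀
    (hL'.comp α₀ (hasFDerivAt_prodMk_right θ₀ α₀))
  exact h1.hessian_mulVec h2 w

theorem jacobian_gradient_fst_mulVec (hL : ∀ᶠ t in 𝓝 (θ₀, α₀), HasFDerivAt L (L' t) t)
    (hL' : HasFDerivAt L' H (θ₀, α₀)) (w : Euc q) :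
    jacobian (fun α => gradient (fun θ => L (θ, α)) θ₀) α₀ *ᵥ w.ofLp =
      (coordFst p q (H (0, w))).ofLp := by
  have hc : Tendsto (fun α : Euc q => (θ₀, α)) (𝓝 α₀) (𝓝 (θ₀, α₀)) := by
    exact Continuous.tendsto (by fun_prop) α₀
  have h2 := (coordFst p q).hasFDerivAt.comp α₀
    (hL'.comp α₀ (hasFDerivAt_prodMk_right θ₀ α₀))
  have h3 := h2.congr_of_eventuallyEq
    ((hc.eventually hL).mono fun α hα => hα.gradient_fst)
  exact h3.jacobian_mulVec w

/-- The implicit function theorem for the critical point equation `∂₂L (θ, a θ) = 0`, when `a` is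
already known to be continuous: `a` coincides with the local inverse of
`(θ, α) ↦ (θ, ∂₂L (θ, α))` along `(θ, 0)`. -/
theorem contDiffAt_of_coordSnd_eq_zero (hC1 : ContDiffAt ℝ 1 L' (θ₀, α₀))
    (hL' : HasFDerivAt L' H (θ₀, α₀)) (hH2 : ∀ w, coordSnd p q (H (0, w)) = 0 → w = 0)
    {a : Euc p → Euc q} (ha : ContinuousAt a θ₀) (ha₀ : a θ₀ = α₀)
    (hcrit : ∀ᶠ θ in 𝓝 θ₀, coordSnd p q (L' (θ, a θ)) = 0) : ContDiffAt ℝ 1 a θ₀ := by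
  let Φ : Euc p × Euc q → Euc p × Euc q := fun t => (t.1, coordSnd p q (L' t))
  let A : Euc p × Euc q →L[ℝ] Euc p × Euc q :=
    (ContinuousLinearMap.fst ℝ (Euc p) (Euc q)).prod ((coordSnd p q).comp H)
  have hA : Function.Injective (A : Euc p × Euc q →ₗ[ℝ] Euc p × Euc q) := by
    refine (injective_iff_map_eq_zero _).2 fun u hu => ?_
    have h1 : u.1 = 0 := congrArg Prod.fst hu
    have h2 : coordSnd p q (H u) = 0 := congrArg Prod.snd hu
    have h3 : u = (0, u.2) := Prod.ext h1 rfl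
    rw [h3] at h2 ⊢
    rw [hH2 _ h2]
    rfl
  let e : (Euc p × Euc q) ≃L[ℝ] Euc p × Euc q :=
    (LinearEquiv.ofInjectiveEndo (A : Euc p × Euc q →ₗ[ℝ] Euc p × Euc q)
      hA).toContinuousLinearEquiv
  have he : (e : Euc p × Euc q →L[ℝ] Euc p × Euc q) = A := by
    ext u <;> rfl
  have hΦ : ContDiffAt ℝ 1 Φ (θ₀, α₀) :=
    contDiffAt_fst.prodMk ((coordSnd p q).contDiff.contDiffAt.comp _ hC1)
  have hΦ' : HasFDerivAt Φ (e : Euc p × Euc q →L[ℝ] Euc p × Euc q) (θ₀, α₀) := by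
    rw [he]
    exact hasFDerivAt_fst.prodMk ((coordSnd p q).hasFDerivAt.comp _ hL')
  have hinv := hΦ.to_localInverse hΦ' one_ne_zero
  have hleft := (hΦ.hasStrictFDerivAt' hΦ' one_ne_zero).eventually_left_inverse
  have hpair : Tendsto (fun θ => (θ, a θ)) (𝓝 θ₀) (𝓝 (θ₀, α₀)) := by
    have := (continuousAt_id (x := θ₀)).prodMk ha
    rwa [ContinuousAt, ha₀] at this
  have hΦ0 : Φ (θ₀, α₀) = (θ₀, 0) := by
    have := hcrit.self_of_nhds
    rw [ha₀] at this
    simp [Φ, this]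
  rw [hΦ0] at hinv
  have hcomp : ContDiffAt ℝ 1
      (fun θ => ((hΦ.localInverse hΦ' one_ne_zero) ((θ, 0) : Euc p × Euc q)).2) θ₀ :=
    contDiffAt_snd.comp θ₀ (hinv.comp θ₀ (contDiffAt_id.prodMk contDiffAt_const))
  refine hcomp.congr_of_eventuallyEq ?_
  filter_upwards [hcrit, hpair.eventually hleft] with θ h1 h2
  have h3 : Φ (θ, a θ) = (θ, 0) := by simp [Φ, h1]
  rw [h3] at h2
  exact (congrArg Prod.snd h2).symm

/-- Let `a θ` solve `∂₂L (θ, a θ) = 0` near `θ₀`, let `S` be the Hessian at `θ₀` of the value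
function `θ ↦ L (θ, a θ)`, and suppose that `S` and `H₂L` are invertible. Then the second
differential `H` of `L` is nondegenerate, and the first component of the solution `u` of
`H u = -g` is the given expression in `g`. Indeed `S` is the Schur complement of `H₂L` in `H`. -/
theorem exists_fst_inverse_of_schur
    (hL : ∀ᶠ t in 𝓝 (θ₀, α₀), HasFDerivAt L (L' t) t)
    (hC1 : ContDiffAt ℝ 1 L' (θ₀, α₀)) (hL' : HasFDerivAt L' H (θ₀, α₀))
    {a : Euc p → Euc q} (ha : ContinuousAt a θ₀) (ha₀ : a θ₀ = α₀)
    (hcrit : ∀ᶠ θ in 𝓝 θ₀, coordSnd p q (L' (θ, a θ)) = 0)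
    {S : Matrix (Fin p) (Fin p) ℝ} (hS : hessian (fun θ => L (θ, a θ)) θ₀ = S) (hSu : IsUnit S)
    {H2 : Matrix (Fin q) (Fin q) ℝ} (hH2 : hessian (fun α => L (θ₀, α)) α₀ = H2)
    (hH2u : IsUnit H2)
    {J : Matrix (Fin p) (Fin q) ℝ}
    (hJ : jacobian (fun α => gradient (fun θ => L (θ, α)) θ₀) α₀ = J) :
    ∃ B : (Euc p × Euc q →L[ℝ] ℝ) →L[ℝ] Euc p,
      (∀ g, B g = WithLp.toLp 2 (-(S⁻¹ *ᵥ (coordFst p q g).ofLp) +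
        (S⁻¹ * J * H2⁻¹) *ᵥ (coordSnd p q g).ofLp)) ∧
      (∀ u, B (H u) = -u.1) ∧ (∀ u, H u = 0 → u = 0) ∧
      ∀ w, coordSnd p q (H (0, w)) = 0 → w = 0 := by
  have hS1 : S⁻¹ * S = 1 := Matrix.nonsing_inv_mul S ((Matrix.isUnit_iff_isUnit_det S).1 hSu)
  have hH21 : H2⁻¹ * H2 = 1 := Matrix.nonsing_inv_mul H2 ((Matrix.isUnit_iff_isUnit_det H2).1 hH2u)
  have hH2v : ∀ w : Euc q, H2 *ᵥ w.ofLp = (coordSnd p q (H (0, w))).ofLp := fun w => by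
    rw [← hH2]
    exact hessian_snd_mulVec hL hL' w
  have hJv : ∀ w : Euc q, J *ᵥ w.ofLp = (coordFst p q (H (0, w))).ofLp := fun w => by
    rw [← hJ]
    exact jacobian_gradient_fst_mulVec hL hL' w
  have hH2inj : ∀ w, coordSnd p q (H (0, w)) = 0 → w = 0 := by
    intro w hw
    have h1 : H2⁻¹ *ᵥ (H2 *ᵥ w.ofLp) = 0 := by rw [hH2v, hw]; simp
    rw [mulVec_mulVec, hH21, one_mulVec] at h1
    exact PiLp.ext fun i => congrFun h1 i
  have haC1 := contDiffAt_of_coordSnd_eq_zero hC1 hL' hH2inj ha ha₀ hcrit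
  obtain ⟨a', ha'⟩ : ∃ a', HasFDerivAt a a' θ₀ :=
    ⟨_, (haC1.differentiableAt one_ne_zero).hasFDerivAt⟩
  have hpair : Tendsto (fun θ => (θ, a θ)) (𝓝 θ₀) (𝓝 (θ₀, α₀)) := by
    have := (continuousAt_id (x := θ₀)).prodMk ha
    rwa [ContinuousAt, ha₀] at this
  let D : Euc p →L[ℝ] Euc p × Euc q := (ContinuousLinearMap.id ℝ (Euc p)).prod a'
  have hcurve : HasFDerivAt (fun θ => (θ, a θ)) D θ₀ := (hasFDerivAt_id θ₀).prodMk ha'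
  have hL'curve : HasFDerivAt (fun θ => L' (θ, a θ)) (H.comp D) θ₀ := by
    rw [← ha₀] at hL'
    exact hL'.comp θ₀ hcurve
  -- differentiation of the critical point equation
  have hHD2 : ∀ v, coordSnd p q (H (v, a' v)) = 0 := by
    intro v
    have h1 := (coordSnd p q).hasFDerivAt.comp θ₀ hL'curve
    have h2 : HasFDerivAt (fun θ => coordSnd p q (L' (θ, a θ))) (0 : Euc p →L[ℝ] Euc q) θ₀ :=
      (hasFDerivAt_const (0 : Euc q) θ₀).congr_of_eventuallyEq hcrit
    exact congrArg (fun T => T v) (h1.unique h2)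
  -- the first differential of the value function
  have hV : ∀ᶠ θ in 𝓝 θ₀, HasFDerivAt (fun θ => L (θ, a θ))
      ((L' (θ, a θ)).comp (ContinuousLinearMap.inl ℝ (Euc p) (Euc q))) θ := by
    have hdiff : ∀ᶠ θ in 𝓝 θ₀, DifferentiableAt ℝ a θ :=
      (haC1.eventually (by simp)).mono fun θ hθ => hθ.differentiableAt one_ne_zero
    filter_upwards [hdiff, hcrit, hpair.eventually hL] with θ h1 h2 h3
    have h4 := h3.comp θ ((hasFDerivAt_id θ).prodMk h1.hasFDerivAt)
    refine h4.congr_fderiv ?_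
    ext v
    have h5 : L' (θ, a θ) (0, fderiv ℝ a θ v) = 0 :=
      congrArg (fun T => T (fderiv ℝ a θ v)) (coordSnd_eq_zero_iff.1 h2)
    have h6 : ((v, fderiv ℝ a θ v) : Euc p × Euc q) = (v, 0) + (0, fderiv ℝ a θ v) := by simp
    change L' (θ, a θ) (v, fderiv ℝ a θ v) = L' (θ, a θ) (v, 0)
    rw [h6, map_add, h5, add_zero]
  have hSv : ∀ v : Euc p, S *ᵥ v.ofLp = (coordFst p q (H (v, a' v))).ofLp := by
    intro v
    rw [← hS]
    have h2 := ((ContinuousLinearMap.compL ℝ (Euc p) (Euc p × Euc q) ℝ).flip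
      (ContinuousLinearMap.inl ℝ (Euc p) (Euc q))).hasFDerivAt.comp θ₀ hL'curve
    exact hV.hessian_mulVec h2 v
  let B : (Euc p × Euc q →L[ℝ] ℝ) →L[ℝ] Euc p :=
    -((LinearMap.toContinuousLinearMap (Matrix.toLpLin 2 2 S⁻¹)).comp (coordFst p q)) +
      (LinearMap.toContinuousLinearMap (Matrix.toLpLin 2 2 (S⁻¹ * J * H2⁻¹))).comp (coordSnd p q)
  have hB : ∀ g, B g = WithLp.toLp 2 (-(S⁻¹ *ᵥ (coordFst p q g).ofLp) +
        (S⁻¹ * J * H2⁻¹) *ᵥ (coordSnd p q g).ofLp) := by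
    intro g
    simp [B, Matrix.toLpLin_apply, Matrix.mul_assoc]
  have hBH : ∀ u, B (H u) = -u.1 := by
    intro u
    -- block elimination: `H` maps `(v, a' v)` to `S v` in the first block and `0` in the second
    have hu : u = (u.1, a' u.1) + (0, u.2 - a' u.1) := by ext <;> simp
    have h1 : (coordFst p q (H u)).ofLp = S *ᵥ u.1.ofLp + J *ᵥ (u.2 - a' u.1).ofLp := by
      conv_lhs => rw [hu, map_add, map_add]
      rw [hSv, hJv]
      rfl
    have h2 : (coordSnd p q (H u)).ofLp = H2 *ᵥ (u.2 - a' u.1).ofLp := by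
      conv_lhs => rw [hu, map_add, map_add, hHD2, zero_add]
      rw [hH2v]
    rw [hB, h1, h2, mulVec_add, mulVec_mulVec, mulVec_mulVec, hS1, one_mulVec, mulVec_mulVec,
      Matrix.mul_assoc _ H2⁻¹, hH21, Matrix.mul_one]
    simp
  refine ⟨B, hB, hBH, fun u hu => ?_, hH2inj⟩
  have h1 : u.1 = 0 := by
    have := hBH u
    rw [hu, map_zero] at this
    exact neg_eq_zero.1 this.symm
  have h3 : u = (0, u.2) := Prod.ext h1 rfl
  rw [h3] at hu ⊢
  rw [hH2inj u.2 (by rw [hu, map_zero])]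
  rfl

/-- Quantitative form of the nondegeneracy of `H` and of its second diagonal block. -/
theorem exists_lower_bound_of_injective (hH : ∀ u, H u = 0 → u = 0)
    (hH2 : ∀ w, coordSnd p q (H (0, w)) = 0 → w = 0) :
    ∃ c > 0, (∀ u, c * ‖u‖ ≤ ‖H u‖) ∧
      ∀ v, c * ‖v‖ ≤ ‖(H (0, v)).comp (ContinuousLinearMap.inr ℝ (Euc p) (Euc q))‖ := by
  obtain ⟨K₁, hK₁, hA₁⟩ := H.toLinearMap.exists_antilipschitzWith (LinearMap.ker_eq_bot'.2 hH)
  let T : Euc q →L[ℝ] Euc q →L[ℝ] ℝ :=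
    ((ContinuousLinearMap.compL ℝ (Euc q) (Euc p × Euc q) ℝ).flip
      (ContinuousLinearMap.inr ℝ (Euc p) (Euc q))).comp
      (H.comp (ContinuousLinearMap.inr ℝ (Euc p) (Euc q)))
  obtain ⟨K₂, hK₂, hA₂⟩ := T.toLinearMap.exists_antilipschitzWith
    (LinearMap.ker_eq_bot'.2 fun w hw => hH2 w (coordSnd_eq_zero_iff.2 hw))
  have hK₁' : (0 : ℝ) < K₁ := hK₁
  have hK₂' : (0 : ℝ) < K₂ := hK₂
  refine ⟨min (K₁ : ℝ)⁻¹ (K₂ : ℝ)⁻¹, by positivity, fun u => ?_, fun v => ?_⟩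
  · have h1 : ‖u‖ ≤ K₁ * ‖H u‖ := by simpa using hA₁.le_mul_dist u 0
    calc _ ≤ (K₁ : ℝ)⁻¹ * ‖u‖ := by gcongr; exact min_le_left _ _
      _ ≤ ‖H u‖ := by rwa [inv_mul_le_iff₀ hK₁']
  · have h1 : ‖v‖ ≤ K₂ * ‖T v‖ := by simpa using hA₂.le_mul_dist v 0
    calc _ ≤ (K₂ : ℝ)⁻¹ * ‖v‖ := by gcongr; exact min_le_right _ _
      _ ≤ ‖T v‖ := by rwa [inv_mul_le_iff₀ hK₂']

/-- Second order analysis of the limiting minimax problem at its solution `(θ₀, α₀)`: the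
solution is a critical point of `L`, the second differential of `L` is nondegenerate there, and
the first component of its inverse is given by the Schur complement. -/
theorem exists_fst_inverse_of_isMinimaxOn {Θ : Set (Euc p)} {Λ : Set (Euc q)} (hΛ : IsCompact Λ)
    {s : Set (Euc p × Euc q)} (hs : IsOpen s) (ht₀ : (θ₀, α₀) ∈ s) (hsK : s ⊆ Θ ×ˢ Λ)
    {L'' : Euc p × Euc q → Euc p × Euc q →L[ℝ] Euc p × Euc q →L[ℝ] ℝ}
    (hLd : ∀ t ∈ s, HasFDerivAt L (L' t) t) (hL'd : ∀ t ∈ s, HasFDerivAt L' (L'' t) t)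
    (hL''c : ∀ᶠ t in 𝓝 (θ₀, α₀), ContinuousAt L'' t) (hLcont : ContinuousOn L (Θ ×ˢ Λ))
    (hmm : IsMinimaxOn Θ Λ L θ₀)
    (huniqα : ∀ α' ∈ Λ, (∀ β ∈ Λ, L (θ₀, β) ≤ L (θ₀, α')) → α' = α₀)
    {a : Euc p → Euc q}
    (ha : ∀ᶠ θ in 𝓝 θ₀, a θ ∈ Λ ∧ ∀ β ∈ Λ, L (θ, β) ≤ L (θ, a θ))
    {S : Matrix (Fin p) (Fin p) ℝ} (hS : hessian (fun θ => L (θ, a θ)) θ₀ = S) (hSu : IsUnit S)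
    {H2 : Matrix (Fin q) (Fin q) ℝ} (hH2 : hessian (fun α => L (θ₀, α)) α₀ = H2)
    (hH2u : IsUnit H2)
    {J : Matrix (Fin p) (Fin q) ℝ}
    (hJ : jacobian (fun α => gradient (fun θ => L (θ, α)) θ₀) α₀ = J) :
    L' (θ₀, α₀) = 0 ∧ ∃ B : (Euc p × Euc q →L[ℝ] ℝ) →L[ℝ] Euc p,
      (∀ g, B g = WithLp.toLp 2 (-(S⁻¹ *ᵥ (coordFst p q g).ofLp) +
        (S⁻¹ * J * H2⁻¹) *ᵥ (coordSnd p q g).ofLp)) ∧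
      (∀ u, B (L'' (θ₀, α₀) u) = -u.1) ∧
      ∃ c > 0, (∀ u, c * ‖u‖ ≤ ‖L'' (θ₀, α₀) u‖) ∧
        ∀ v, c * ‖v‖ ≤
          ‖(L'' (θ₀, α₀) (0, v)).comp (ContinuousLinearMap.inr ℝ (Euc p) (Euc q))‖ := by
  have hst₀ : s ∈ 𝓝 (θ₀, α₀) := hs.mem_nhds ht₀
  have hΛnhds := prod_mem_nhds_iff.1 (mem_of_superset hst₀ hsK)
  have hC1 : ContDiffAt ℝ 1 L' (θ₀, α₀) := by
    refine contDiffAt_one_iff.2 ⟨L'', {t | t ∈ s ∧ ContinuousAt L'' t}, ?_,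
      fun t ht => ht.2.continuousWithinAt, fun t ht => hL'd t ht.1⟩
    filter_upwards [hst₀, hL''c] with t h1 h2 using ⟨h1, h2⟩
  have hstrict : HasStrictFDerivAt L (L' (θ₀, α₀)) (θ₀, α₀) :=
    hasStrictFDerivAt_of_hasFDerivAt_of_continuousAt
      (by filter_upwards [hst₀] with t ht using hLd t ht) hC1.continuousAt
  -- the inner maximizer `a` is continuous at `θ₀` and solves the critical point equation
  have haΛ := ha.self_of_nhds
  have ha₀ : a θ₀ = α₀ := huniqα _ haΛ.1 haΛ.2
  have hac : ContinuousAt a θ₀ := by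
    rw [ContinuousAt, ha₀]
    exact tendsto_of_forall_isMax (F := fun _ => L) (L := L) hΛ
      (fun u hu => Eventually.of_forall fun _ x _ => refl_mem_uniformity hu) hLcont
      tendsto_id hΛnhds.1 (mem_of_mem_nhds hΛnhds.1) ha huniqα
  have hpair : Tendsto (fun θ => (θ, a θ)) (𝓝 θ₀) (𝓝 (θ₀, α₀)) := by
    have := (continuousAt_id (x := θ₀)).prodMk hac
    rwa [ContinuousAt, ha₀] at this
  have hcrit : ∀ᶠ θ in 𝓝 θ₀, coordSnd p q (L' (θ, a θ)) = 0 := by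
    filter_upwards [ha, hpair.eventually (hs.mem_nhds ht₀)] with θ h1 h2
    rw [coordSnd_eq_zero_iff]
    ext v
    exact fderiv_inr_eq_zero_of_isMax
      (prod_mem_nhds_iff.1 (mem_of_superset (hs.mem_nhds h2) hsK)).2 h1.2 (hLd _ h2) v
  have hL'0 : L' (θ₀, α₀) = 0 := by
    ext v
    · exact fderiv_inl_eq_zero_of_isMinimaxOn hΛ hLcont hΛnhds.1 hmm (mem_of_mem_nhds hΛnhds.2) huniqα
        hstrict v
    · have := hcrit.self_of_nhds
      rw [ha₀, coordSnd_eq_zero_iff] at this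
      exact congrArg (fun T => T v) this
  obtain ⟨B, hB, hBH, hHinj, hH2inj⟩ := exists_fst_inverse_of_schur
    (eventually_of_mem hst₀ hLd) hC1 (hL'd (θ₀, α₀) ht₀) hac ha₀ hcrit hS hSu hH2 hH2u hJ
  exact ⟨hL'0, B, hB, hBH, exists_lower_bound_of_injective hHinj hH2inj⟩

end ValueFunction

/-! ### Expectations and empirical means of smooth families of functions -/

section SmoothFamily

/-- A family `f` of functions on `S`, depending measurably on a parameter, with values and
differentials of orders 1 and 2 bounded by `C` uniformly in the parameter. -/
structure IsSmoothFamily {𝒲 V : Type*} [MeasurableSpace 𝒲] [NormedAddCommGroup V]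
    [NormedSpace ℝ V] (f : 𝒲 → V → ℝ) (S : Set V) (C : ℝ) : Prop where
  measurable : ∀ t ∈ S, Measurable fun w => f w t
  bound : ∀ w, ∀ t ∈ S, ‖f w t‖ ≤ C
  c2BddOn : ∀ w, C2BddOn (f w) S C

theorem IsSmoothFamily.mono {𝒲 V : Type*} [MeasurableSpace 𝒲] [NormedAddCommGroup V]
    [NormedSpace ℝ V] {f : 𝒲 → V → ℝ} {S s : Set V} {C : ℝ} (hf : IsSmoothFamily f S C) (h : s ⊆ S) : IsSmoothFamily f s C :=
  ⟨fun t ht => hf.measurable t (h ht), fun w t ht => hf.bound w t (h ht),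
    fun w => (hf.c2BddOn w).mono h le_rfl⟩

variable {Ω 𝒲 V G : Type*} [MeasurableSpace Ω] {P : Measure Ω} [IsProbabilityMeasure P]
  [MeasurableSpace 𝒲] [NormedAddCommGroup V] [NormedSpace ℝ V] [FiniteDimensional ℝ V]

/-- Differentiation under the expectation. -/
theorem hasFDerivAt_integral_of_bound [NormedAddCommGroup G] [NormedSpace ℝ G]
    [FiniteDimensional ℝ G] [MeasurableSpace G] [BorelSpace G]
    {W : Ω → 𝒲} (hW : AEMeasurable W P) {g : 𝒲 → V → G}
    {s : Set V} (hs : IsOpen s) (hm : ∀ t ∈ s, Measurable fun w => g w t)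
    (hd : ∀ w, ∀ t ∈ s, HasFDerivAt (g w) (fderiv ℝ (g w) t) t) {C : ℝ}
    (hC : ∀ w, ∀ t ∈ s, ‖g w t‖ ≤ C) (hC' : ∀ w, ∀ t ∈ s, ‖fderiv ℝ (g w) t‖ ≤ C)
    {t : V} (ht : t ∈ s) :
    HasFDerivAt (fun t => ∫ ω, g (W ω) t ∂P) (∫ ω, fderiv ℝ (g (W ω)) t ∂P) t := by
  have hmeas : ∀ t ∈ s, AEStronglyMeasurable (fun ω => g (W ω) t) P := fun t ht =>
    ((hm t ht).comp_aemeasurable hW).aestronglyMeasurable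
  refine hasFDerivAt_integral_of_dominated_of_fderiv_le (s := s) (bound := fun _ => C)
    (F' := fun t ω => fderiv ℝ (g (W ω)) t) (hs.mem_nhds ht) ?_ ?_ ?_ ?_ (integrable_const C) ?_
  · filter_upwards [hs.mem_nhds ht] with t ht using hmeas t ht
  · exact Integrable.of_bound (hmeas t ht) C (ae_of_all _ fun ω => hC _ t ht)
  · exact ((measurable_fderiv_param hs hm ht fun w =>
      (hd w t ht).differentiableAt).comp_aemeasurable hW).aestronglyMeasurable
  · exact ae_of_all _ fun ω t ht => hC' _ t ht
  · exact ae_of_all _ fun ω t ht => hd _ t ht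

variable {f : 𝒲 → V → ℝ} {S s : Set V} {C : ℝ}

theorem IsSmoothFamily.measurable_fderiv (hf : IsSmoothFamily f s C) (hs : IsOpen s) {t : V}
    (ht : t ∈ s) : Measurable fun w => fderiv ℝ (f w) t :=
  measurable_fderiv_param hs hf.measurable ht fun w =>
    (((hf.c2BddOn w).fderiv_of_isOpen hs).1 t ht).differentiableAt

theorem IsSmoothFamily.measurable_fderiv_fderiv (hf : IsSmoothFamily f s C) (hs : IsOpen s)
    {t : V} (ht : t ∈ s) : Measurable fun w => fderiv ℝ (fderiv ℝ (f w)) t :=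
  measurable_fderiv_param (G := V →L[ℝ] ℝ) hs (fun _ ht => hf.measurable_fderiv hs ht) ht fun w =>
    (((hf.c2BddOn w).fderiv_of_isOpen hs).2.1 t ht).differentiableAt

theorem IsSmoothFamily.hasFDerivAt_integral (hf : IsSmoothFamily f s C) (hs : IsOpen s)
    {W : Ω → 𝒲} (hW : AEMeasurable W P) {t : V} (ht : t ∈ s) :
    HasFDerivAt (fun t => ∫ ω, f (W ω) t ∂P) (∫ ω, fderiv ℝ (f (W ω)) t ∂P) t :=
  hasFDerivAt_integral_of_bound hW hs hf.measurable
    (fun w => ((hf.c2BddOn w).fderiv_of_isOpen hs).1) hf.bound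
    (fun w t ht => (((hf.c2BddOn w).fderiv_of_isOpen hs).2.2.2 t ht).1) ht

theorem IsSmoothFamily.hasFDerivAt_integral_fderiv (hf : IsSmoothFamily f s C) (hs : IsOpen s)
    {W : Ω → 𝒲} (hW : AEMeasurable W P) {t : V} (ht : t ∈ s) :
    HasFDerivAt (fun t => ∫ ω, fderiv ℝ (f (W ω)) t ∂P)
      (∫ ω, fderiv ℝ (fderiv ℝ (f (W ω))) t ∂P) t :=
  hasFDerivAt_integral_of_bound (G := V →L[ℝ] ℝ) hW hs
    (fun _ ht => hf.measurable_fderiv hs ht)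
    (fun w => ((hf.c2BddOn w).fderiv_of_isOpen hs).2.1)
    (fun w t ht => (((hf.c2BddOn w).fderiv_of_isOpen hs).2.2.2 t ht).1)
    (fun w t ht => (((hf.c2BddOn w).fderiv_of_isOpen hs).2.2.2 t ht).2) ht

variable {W : ℕ → Ω → 𝒲}

/-- Uniform law of large numbers for the values of a smooth family on a compact set. -/
theorem IsSmoothFamily.tendstoUniformlyOn (hf : IsSmoothFamily f S C) (hS : IsCompact S)
    (hind : iIndepFun W P) (hid : ∀ i, IdentDistrib (W i) (W 0) P P) :
    ContinuousOn (fun t => ∫ ω, f (W 0 ω) t ∂P) S ∧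
    ∀ᵐ ω ∂P, TendstoUniformlyOn (fun (n : ℕ) t => (n : ℝ)⁻¹ • ∑ i ∈ Finset.range n, f (W i ω) t)
      (fun t => ∫ ω, f (W 0 ω) t ∂P) atTop S := by
  have : CompactSpace S := isCompact_iff_compactSpace.1 hS
  have := uniform_strong_law hind hid (g := fun w (k : S) => f w k)
    (fun w => continuousOn_iff_continuous_domRestrict.1 (hf.c2BddOn w).continuousOn)
    (fun k => hf.measurable k k.2) (fun w k => hf.bound w k k.2)
  refine ⟨continuousOn_iff_continuous_domRestrict.2 this.1, ?_⟩
  filter_upwards [this.2] with ω hω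
  exact tendstoUniformlyOn_iff_tendstoUniformly_comp_coe.2 hω

/-- Uniform law of large numbers for the second differentials of a smooth family near a point. -/
theorem IsSmoothFamily.eventually_norm_sub_le (hf : IsSmoothFamily f s C) (hs : IsOpen s)
    (hind : iIndepFun W P) (hid : ∀ i, IdentDistrib (W i) (W 0) P P) {t₀ : V} (ht₀ : t₀ ∈ s) :
    (∀ᶠ t in 𝓝 t₀, ContinuousAt (fun t => ∫ ω, fderiv ℝ (fderiv ℝ (f (W 0 ω))) t ∂P) t) ∧
    ∀ᵐ ω ∂P, ∀ ε > 0, ∃ δ > 0, ∀ᶠ n : ℕ in atTop, ∀ t ∈ Metric.ball t₀ δ,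
      ‖(n : ℝ)⁻¹ • ∑ i ∈ Finset.range n, fderiv ℝ (fderiv ℝ (f (W i ω))) t -
        ∫ ω, fderiv ℝ (fderiv ℝ (f (W 0 ω))) t₀ ∂P‖ ≤ ε := by
  obtain ⟨r, hr, hrs⟩ := Metric.nhds_basis_closedBall.mem_iff.1 (hs.mem_nhds ht₀)
  have : ProperSpace V := FiniteDimensional.proper ℝ V
  have : CompactSpace (Metric.closedBall t₀ r) :=
    isCompact_iff_compactSpace.1 (isCompact_closedBall t₀ r)
  obtain ⟨h1, h2⟩ := uniform_strong_law hind hid (F := V →L[ℝ] V →L[ℝ] ℝ)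
    (g := fun w (k : Metric.closedBall t₀ r) => fderiv ℝ (fderiv ℝ (f w)) k)
    (fun w => continuousOn_iff_continuous_domRestrict.1
      (((hf.c2BddOn w).fderiv_of_isOpen hs).2.2.1.mono hrs))
    (fun k => hf.measurable_fderiv_fderiv hs (hrs k.2))
    (fun w k => (((hf.c2BddOn w).fderiv_of_isOpen hs).2.2.2 _ (hrs k.2)).2)
  have hcont : ContinuousOn (fun t => ∫ ω, fderiv ℝ (fderiv ℝ (f (W 0 ω))) t ∂P)
      (Metric.closedBall t₀ r) := continuousOn_iff_continuous_domRestrict.2 h1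
  have hca : ∀ t ∈ Metric.ball t₀ r,
      ContinuousAt (fun t => ∫ ω, fderiv ℝ (fderiv ℝ (f (W 0 ω))) t ∂P) t := fun t ht =>
    hcont.continuousAt (mem_of_superset (Metric.isOpen_ball.mem_nhds ht)
      Metric.ball_subset_closedBall)
  refine ⟨?_, ?_⟩
  · filter_upwards [Metric.ball_mem_nhds t₀ hr] with t ht using hca t ht
  · filter_upwards [h2] with ω hω ε hε
    obtain ⟨δ, hδ, hδc⟩ := Metric.continuousAt_iff (β := V →L[ℝ] V →L[ℝ] ℝ).1 (hca t₀ (Metric.mem_ball_self hr)) (ε / 2)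
      (half_pos hε)
    refine ⟨min δ r, lt_min hδ hr, ?_⟩
    filter_upwards [Metric.tendstoUniformly_iff.1 hω (ε / 2) (half_pos hε)] with n hn t ht
    have htr : t ∈ Metric.closedBall t₀ r :=
      Metric.ball_subset_closedBall (Metric.ball_subset_ball (min_le_right _ _) ht)
    have a1 := hn ⟨t, htr⟩
    have a2 := hδc (Metric.ball_subset_ball (min_le_left _ _) ht)
    rw [dist_comm] at a1
    have tri : ∀ x y z : V →L[ℝ] V →L[ℝ] ℝ, dist x y < ε / 2 → dist y z < ε / 2 →
        ‖x - z‖ ≤ ε := fun x y z h h' =>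
      (dist_eq_norm x z).symm.trans_le ((dist_triangle x y z).trans (by linarith))
    exact tri _ _ _ a1 a2

end SmoothFamily

/-! ### Asymptotic normality of minimax estimators -/

theorem hasFDerivAt_smul_sum {ι V G : Type*} [NormedAddCommGroup V] [NormedSpace ℝ V]
    [NormedAddCommGroup G] [NormedSpace ℝ G] (c : ℝ) (u : Finset ι) {g : ι → V → G}
    {g' : ι → V →L[ℝ] G} {t : V} (h : ∀ i, HasFDerivAt (g i) (g' i) t) :
    HasFDerivAt (fun t => c • ∑ i ∈ u, g i t) (c • ∑ i ∈ u, g' i) t :=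
  (HasFDerivAt.fun_sum fun i _ => h i).fun_const_smul c

section MinimaxEstimator

variable {Ω 𝒲 : Type*} [MeasurableSpace Ω] {P : Measure Ω} [IsProbabilityMeasure P]
  [MeasurableSpace 𝒲] {p q : ℕ} {W : ℕ → Ω → 𝒲} {f : 𝒲 → Euc p × Euc q → ℝ}
  {Θ : Set (Euc p)} {Λ : Set (Euc q)} {C : ℝ} {L : Euc p × Euc q → ℝ}

theorem IsMinimaxOn.const_smul {T A : Type*} {Θ : Set T} {Λ : Set A} {F : T × A → ℝ} {θ : T}
    (h : IsMinimaxOn Θ Λ F θ) {c : ℝ} (hc : 0 ≤ c) : IsMinimaxOn Θ Λ (fun t => c • F t) θ := by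
  refine ⟨h.1, fun θ' hθ' => ?_⟩
  obtain ⟨β, hβ, h2⟩ := h.2 θ' hθ'
  exact ⟨β, hβ, fun α hα => mul_le_mul_of_nonneg_left (h2 α hα) hc⟩

/-- If `B` sends `H u` to `-u.1`, an approximate solution `u` of `H u = -g` has a first component
close to `B g`; both sides are rescaled by `r`. -/
theorem norm_smul_fst_sub_le {V₁ V₂ G : Type*} [NormedAddCommGroup V₁] [NormedSpace ℝ V₁]
    [NormedAddCommGroup V₂] [NormedSpace ℝ V₂] [NormedAddCommGroup G] [NormedSpace ℝ G]
    {H : V₁ × V₂ →L[ℝ] G} {B : G →L[ℝ] V₁} (hBH : ∀ u, B (H u) = -u.1) {ε : ℝ} (hε : 0 < ε)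
    {u : V₁ × V₂} {g : G} (h : ‖H u + g‖ ≤ ε / (‖B‖ + 1) * ‖g‖) (r : ℝ) :
    ‖r • u.1 - B (r • g)‖ ≤ ε * ‖r • g‖ := by
  have hBpos : 0 < ‖B‖ + 1 := by positivity
  have h1 : r • u.1 - B (r • g) = -(r • B (H u + g)) := by
    rw [map_add, hBH, map_smul, smul_add, smul_neg]
    abel
  rw [h1, norm_neg, norm_smul, norm_smul]
  calc ‖r‖ * ‖B (H u + g)‖ ≤ ‖r‖ * (‖B‖ * (ε / (‖B‖ + 1) * ‖g‖)) := by
        gcongr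
        exact (B.le_opNorm _).trans (by gcongr)
    _ = (‖B‖ / (‖B‖ + 1)) * (ε * (‖r‖ * ‖g‖)) := by ring
    _ ≤ 1 * (ε * (‖r‖ * ‖g‖)) := by
        gcongr
        rw [div_le_one hBpos]
        linarith
    _ = ε * (‖r‖ * ‖g‖) := one_mul _

set_option maxHeartbeats 1000000 in
/-- The central limit theorem for a minimax estimator: `θhat n` minimizes
`sup_{α ∈ Λ} ∑_{i < n} f (W i) (·, α)`, and `(θ₀, α₀)` is the unique solution of the limiting
problem. -/
theorem tendstoInDistribution_of_isMinimaxOn (hΘ : IsCompact Θ) (hΛ : IsCompact Λ)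
    (hind : iIndepFun W P) (hid : ∀ i, IdentDistrib (W i) (W 0) P P)
    (hf : IsSmoothFamily f (Θ ×ˢ Λ) C)
    (hLf : ∀ t ∈ Θ ×ˢ Λ, L t = ∫ ω, f (W 0 ω) t ∂P)
    {θ₀ : Euc p} {α₀ : Euc q} (hθ₀ : Θ ∈ 𝓝 θ₀) (hα₀ : Λ ∈ 𝓝 α₀)
    (hmm : IsMinimaxOn Θ Λ L θ₀) (huniqθ : ∀ θ', IsMinimaxOn Θ Λ L θ' → θ' = θ₀)
    (huniqα : ∀ α' ∈ Λ, (∀ β ∈ Λ, L (θ₀, β) ≤ L (θ₀, α')) → α' = α₀)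
    {a : Euc p → Euc q}
    (ha : ∀ᶠ θ in 𝓝 θ₀, a θ ∈ Λ ∧ ∀ β ∈ Λ, L (θ, β) ≤ L (θ, a θ))
    {S : Matrix (Fin p) (Fin p) ℝ} (hS : hessian (fun θ => L (θ, a θ)) θ₀ = S) (hSu : IsUnit S)
    {H2 : Matrix (Fin q) (Fin q) ℝ} (hH2 : hessian (fun α => L (θ₀, α)) α₀ = H2)
    (hH2u : IsUnit H2)
    {J : Matrix (Fin p) (Fin q) ℝ}
    (hJ : jacobian (fun α => gradient (fun θ => L (θ, α)) θ₀) α₀ = J)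
    {θhat : ℕ → Ω → Euc p} (hmeas : ∀ n, AEMeasurable (θhat n) P)
    (hθhat : ∀ n, ∀ᵐ ω ∂P,
      IsMinimaxOn Θ Λ (fun t => ∑ i ∈ Finset.range n, f (W i ω) t) (θhat n ω))
    {Y : 𝒲 → Euc p}
    (hY : ∀ᵐ ω ∂P, Y (W 0 ω) = WithLp.toLp 2
      (-(S⁻¹ *ᵥ (coordFst p q (fderiv ℝ (f (W 0 ω)) (θ₀, α₀))).ofLp) +
        (S⁻¹ * J * H2⁻¹) *ᵥ (coordSnd p q (fderiv ℝ (f (W 0 ω)) (θ₀, α₀))).ofLp)) :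
    MemLp (fun ω => Y (W 0 ω)) 2 P ∧
    TendstoInDistribution (fun (n : ℕ) ω => √n • (θhat n ω - θ₀)) atTop id (fun _ => P)
      (multivariateGaussian 0 (covMat P fun ω => Y (W 0 ω))) := by
  set t₀ : Euc p × Euc q := (θ₀, α₀)
  set s : Set (Euc p × Euc q) := interior (Θ ×ˢ Λ)
  have hs : IsOpen s := isOpen_interior
  have hsK : s ⊆ Θ ×ˢ Λ := interior_subset
  have ht₀ : t₀ ∈ s := mem_interior_iff_mem_nhds.2 (prod_mem_nhds hθ₀ hα₀)
  have hst₀ : s ∈ 𝓝 t₀ := hs.mem_nhds ht₀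
  have hfs : IsSmoothFamily f s C := hf.mono hsK
  have hW0 : AEMeasurable (W 0) P := (hid 0).aemeasurable_fst
  -- the population criterion
  set L' : Euc p × Euc q → Euc p × Euc q →L[ℝ] ℝ := fun t => ∫ ω, fderiv ℝ (f (W 0 ω)) t ∂P
  set L'' : Euc p × Euc q → Euc p × Euc q →L[ℝ] Euc p × Euc q →L[ℝ] ℝ :=
    fun t => ∫ ω, fderiv ℝ (fderiv ℝ (f (W 0 ω))) t ∂P
  have hLd : ∀ t ∈ s, HasFDerivAt L (L' t) t := fun t ht =>
    (hfs.hasFDerivAt_integral hs hW0 ht).congr_of_eventuallyEq <| by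
      filter_upwards [hs.mem_nhds ht] with u hu using hLf u (hsK hu)
  have hL'd : ∀ t ∈ s, HasFDerivAt L' (L'' t) t := fun t ht =>
    hfs.hasFDerivAt_integral_fderiv hs hW0 ht
  obtain ⟨hLcont', hunif⟩ := hf.tendstoUniformlyOn (hΘ.prod hΛ) hind hid
  have hLcont : ContinuousOn L (Θ ×ˢ Λ) := hLcont'.congr hLf
  obtain ⟨hL''c, hsecond⟩ := hfs.eventually_norm_sub_le hs hind hid ht₀
  obtain ⟨hL'0, B, hB, hBH, c, hc, hHc, hH2c⟩ := exists_fst_inverse_of_isMinimaxOn hΛ hs ht₀ hsK hLd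
    hL'd hL''c hLcont hmm huniqα ha hS hSu hH2 hH2u hJ
  -- the asymptotic linear expansion
  set ξ : ℕ → Ω → Euc p × Euc q →L[ℝ] ℝ := fun i ω => fderiv ℝ (f (W i ω)) t₀
  have hξm : Measurable fun w => fderiv ℝ (f w) t₀ := hfs.measurable_fderiv hs ht₀
  have hξid : ∀ i, IdentDistrib (ξ i) (ξ 0) P P := fun i => (hid i).comp hξm
  have hξind : iIndepFun ξ P := hind.comp (fun _ w => fderiv ℝ (f w) t₀) fun _ => hξm
  have hξC : ∀ w, ‖fderiv ℝ (f w) t₀‖ ≤ C := fun w =>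
    (((hfs.c2BddOn w).fderiv_of_isOpen hs).2.2.2 t₀ ht₀).1
  have hYB : (fun ω => Y (W 0 ω)) =ᵐ[P] fun ω => B (ξ 0 ω) := by
    filter_upwards [hY] with ω hω
    rw [hω, hB]
  have hmem : MemLp (fun ω => B (ξ 0 ω)) 2 P :=
    B.comp_memLp' (MemLp.of_bound (hξid 0).aemeasurable_fst.aestronglyMeasurable C
      (ae_of_all _ fun ω => hξC _))
  refine ⟨(memLp_congr_ae hYB).2 hmem, ?_⟩
  rw [covMat_congr_ae hYB]
  refine tendstoInDistribution_of_linear_expansion (ξ := ξ) (ae_of_all _ fun ω => hξC _) hL'0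
    hξind hξid B
    (fun n => ((hmeas n).sub_const θ₀).fun_const_smul (√n)) ?_
  filter_upwards [hunif, hsecond, ae_all_iff.2 hθhat] with ω hω1 hω2 hω3
  have hlin := exists_linearization_of_isMinimaxOn hΘ hΛ
    (F := fun (n : ℕ) t => (n : ℝ)⁻¹ • ∑ i ∈ Finset.range n, f (W i ω) t)
    (F' := fun (n : ℕ) t => (n : ℝ)⁻¹ • ∑ i ∈ Finset.range n, fderiv ℝ (f (W i ω)) t)
    (F'' := fun (n : ℕ) t => (n : ℝ)⁻¹ • ∑ i ∈ Finset.range n, fderiv ℝ (fderiv ℝ (f (W i ω))) t)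
    (L := L) (hω1.congr_right fun t ht => (hLf t ht).symm) hLcont
    (fun n => (continuousOn_finsetSum _ fun i _ =>
      (hf.c2BddOn (W i ω)).continuousOn).fun_const_smul _)
    hst₀ hsK
    (fun n t ht => hasFDerivAt_smul_sum (n : ℝ)⁻¹ (Finset.range n)
      (g := fun i => f (W i ω)) fun i => ((hfs.c2BddOn (W i ω)).fderiv_of_isOpen hs).1 t ht)
    (fun n t ht => hasFDerivAt_smul_sum (n : ℝ)⁻¹ (Finset.range n)
      (g := fun i => fderiv ℝ (f (W i ω)))
      fun i => ((hfs.c2BddOn (W i ω)).fderiv_of_isOpen hs).2.1 t ht)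
    hω2 hc hHc hH2c huniqθ huniqα
    (θ := fun n => θhat n ω) (Eventually.of_forall fun n => (hω3 n).const_smul (by positivity))
  obtain ⟨u, hu1, hu⟩ := hlin
  intro ε hε
  have hBpos : 0 < ‖B‖ + 1 := by positivity
  filter_upwards [hu (ε / (‖B‖ + 1)) (by positivity), eventually_gt_atTop 0] with n hn hn0
  have hn0' : (0 : ℝ) < n := by exact_mod_cast hn0
  have hsqrt : √(n : ℝ) * (n : ℝ)⁻¹ = (√(n : ℝ))⁻¹ := by
    have h2 := Real.mul_self_sqrt hn0'.le
    field_simp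
    nlinarith
  have hSg : (√(n : ℝ))⁻¹ • ∑ i ∈ Finset.range n, ξ i ω =
      √(n : ℝ) • (n : ℝ)⁻¹ • ∑ i ∈ Finset.range n, fderiv ℝ (f (W i ω)) t₀ := by
    rw [smul_smul, hsqrt]
  rw [hSg, ← hu1 n]
  exact norm_smul_fst_sub_le hBH hε hn _

end MinimaxEstimator

/-! ### The adversarial model -/

namespace GANModel

variable {d d' p q : ℕ} (M : GANModel d d' p q)

/-- The contribution of the pair `w = (x, z)` to the empirical criterion at the pair of
parameters `t = (θ, α)`, set to `0` when `x ∉ E`, where the discriminators carry no assumption. -/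
noncomputable def contrib (w : Euc d × Euc d') (t : Euc p × Euc q) : ℝ :=
  (Prod.fst ⁻¹' M.E).indicator (fun w => M.ell w.1 w.2 t.1 t.2) w

variable {M}

theorem contrib_of_mem {w : Euc d × Euc d'} (hw : w.1 ∈ M.E) :
    M.contrib w = fun t => M.ell w.1 w.2 t.1 t.2 :=
  funext fun _ => Set.indicator_of_mem (s := Prod.fst ⁻¹' M.E) hw _

theorem contrib_of_notMem {w : Euc d × Euc d'} (hw : w.1 ∉ M.E) : M.contrib w = fun _ => 0 :=
  funext fun _ => Set.indicator_of_notMem (s := Prod.fst ⁻¹' M.E) hw _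

theorem IsSample.X_mem {Ω : Type*} [MeasurableSpace Ω] {P : Measure Ω} {X : ℕ → Ω → Euc d}
    {Z : ℕ → Ω → Euc d'} (h : M.IsSample P X Z) : ∀ᵐ ω ∂P, ∀ i, X i ω ∈ M.E := by
  have h0 : ∀ᵐ x ∂(P.map (X 0)), x ∈ M.E := by
    rw [h.map_X]
    exact (withDensity_absolutelyContinuous _ _).ae_le (mem_ae_iff.2 M.μ_compl_E)
  refine ae_all_iff.2 fun i => ?_
  have hX : IdentDistrib (X i) (X 0) P P := (h.identDistrib i).comp measurable_fst
  rw [← hX.map_eq] at h0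
  exact ae_of_ae_map (h.measurable_X i).aemeasurable h0

theorem HReg.continuousOn_D (h : M.HReg) {α : Euc q} (hα : α ∈ M.Λ) :
    ContinuousOn (M.D α) M.E := by
  obtain ⟨K, hK⟩ := h.regD.2
  exact hK.c2BddOn.continuousOn.comp (f := fun x => (x, α)) (by fun_prop) fun x hx => ⟨hx, hα⟩

theorem HReg.measurable_indicator_D (h : M.HReg) {α : Euc q} (hα : α ∈ M.Λ) :
    Measurable (M.E.indicator (M.D α)) := by
  classical
  rw [← Set.piecewise_eq_indicator]
  exact (h.continuousOn_D hα).measurable_piecewise continuousOn_const M.measurableSet_E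

theorem abs_log_le_of_mem_Icc {κ y : ℝ} (hκ : 0 < κ) (h1 : κ ≤ y) (h2 : y ≤ 1) :
    |Real.log y| ≤ -Real.log κ := by
  rw [abs_of_nonpos (Real.log_nonpos (hκ.le.trans h1) h2)]
  exact neg_le_neg (Real.log_le_log hκ h1)

theorem HReg.measurable_log_D (h : M.HReg) {α : Euc q} (hα : α ∈ M.Λ) :
    Measurable fun x => Real.log (M.E.indicator (M.D α) x) :=
  Real.measurable_log.comp (h.measurable_indicator_D hα)

theorem HReg.measurable_log_one_sub_D (h : M.HReg) {α : Euc q} (hα : α ∈ M.Λ) :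
    Measurable fun x => Real.log (1 - M.E.indicator (M.D α) x) :=
  Real.measurable_log.comp ((h.measurable_indicator_D hα).const_sub 1)

theorem HReg.measurable_contrib (h : M.HReg) {t : Euc p × Euc q} (ht : t ∈ M.Θ ×ˢ M.Λ) :
    Measurable fun w => M.contrib w t := by
  have h1 : (fun w => M.contrib w t) = (Prod.fst ⁻¹' M.E).indicator fun w =>
      Real.log (M.E.indicator (M.D t.2) w.1) +
        Real.log (1 - M.E.indicator (M.D t.2) (M.G t.1 w.2)) := by
    funext w
    by_cases hw : w.1 ∈ M.E
    · rw [contrib_of_mem hw, Set.indicator_of_mem (s := Prod.fst ⁻¹' M.E) hw,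
        Set.indicator_of_mem hw, Set.indicator_of_mem (M.G_mem t.1 ht.1 w.2)]
      rfl
    · rw [contrib_of_notMem hw, Set.indicator_of_notMem (s := Prod.fst ⁻¹' M.E) hw]
  rw [h1]
  exact (((h.measurable_log_D ht.2).comp measurable_fst).add ((h.measurable_log_one_sub_D ht.2).comp
    ((M.measurable_G t.1 ht.1).comp measurable_snd))).indicator (measurable_fst M.measurableSet_E)

/-- The contributions `(θ, α) ↦ ln D_α(x) + ln(1 - D_α(G_θ(z)))` are of class `C²` with bounds that
do not depend on `(x, z)`: the logarithms are only evaluated on `[κ, 1 - κ]`, where they are smooth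
with bounded derivatives. -/
theorem HReg.exists_isSmoothFamily (h : M.HReg) :
    ∃ C, IsSmoothFamily M.contrib (M.Θ ×ˢ M.Λ) C := by
  obtain ⟨⟨κ, hκ, hκ2, hD⟩, K, hK⟩ := h.regD
  obtain ⟨K', hG⟩ := h.regG
  -- the two logarithms, on the range of the discriminators
  have hlog : ContDiffOn ℝ 2 Real.log (Set.Ioi 0) := fun y hy =>
    (Real.contDiffAt_log.2 (ne_of_gt hy)).contDiffWithinAt
  have hlog' : ContDiffOn ℝ 2 (fun y => Real.log (1 - y)) (Set.Iio 1) := fun y hy =>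
    ((Real.contDiffAt_log.2 (ne_of_gt (sub_pos.2 hy))).comp y
      (contDiffAt_const.sub contDiffAt_id)).contDiffWithinAt
  obtain ⟨K₁, h1⟩ := hlog.exists_c2BddOn (s := Set.Icc κ (1 - κ)) isOpen_Ioi isCompact_Icc
    fun y hy => hκ.trans_le hy.1
  obtain ⟨K₂, h2⟩ := hlog'.exists_c2BddOn (s := Set.Icc κ (1 - κ)) isOpen_Iio isCompact_Icc
    fun y hy => lt_of_le_of_lt hy.2 (by linarith)
  have hDm : Set.MapsTo (fun w : Euc d × Euc q => M.D w.2 w.1) (M.E ×ˢ M.Λ)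
      (Set.Icc κ (1 - κ)) := fun w hw => hD w.2 hw.2 w.1 hw.1
  have g1 := h1.comp hK.c2BddOn hDm
  have g2 := h2.comp hK.c2BddOn hDm
  set C₁ := K₁ * K + K₁ * K * K
  set C₂ := K₂ * K + K₂ * K * K
  -- the inner maps `(θ, α) ↦ (x, α)` and `(θ, α) ↦ (G θ z, α)`
  let R : Euc p × Euc q →L[ℝ] Euc d × Euc q :=
    (ContinuousLinearMap.inr ℝ (Euc d) (Euc q)).comp (ContinuousLinearMap.snd ℝ (Euc p) (Euc q))
  let F := ContinuousLinearMap.fst ℝ (Euc p) (Euc q)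
  let I := ContinuousLinearMap.inl ℝ (Euc d) (Euc q)
  let S := M.Θ ×ˢ M.Λ
  have i1 : ∀ x, C2BddOn (fun t : Euc p × Euc q => (x, t.2)) S ‖R‖ := fun x =>
    ((R.c2BddOn S).add_const (x, 0)).congr fun t _ => by simp [R]
  set C₅ := K' * ‖F‖ + K' * ‖F‖ * ‖F‖
  set C₃ := ‖I‖ * C₅ + ‖I‖ * C₅ * C₅ + ‖R‖
  have i2 : ∀ z, C2BddOn (fun t : Euc p × Euc q => (M.G t.1 z, t.2)) S C₃ := by
    intro z
    have a1 := (hG z).2.c2BddOn.comp (F.c2BddOn S) fun t ht => ht.1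
    have a2 := ((I.c2BddOn Set.univ).comp a1 (Set.mapsTo_univ _ _)).add (R.c2BddOn S)
    exact a2.congr fun t _ => by simp [I, R, F]
  have c1 : ∀ x ∈ M.E, C2BddOn (fun t : Euc p × Euc q => Real.log (M.D t.2 x)) S
      (C₁ * ‖R‖ + C₁ * ‖R‖ * ‖R‖) := fun x hx => g1.comp (i1 x) fun t ht => ⟨hx, ht.2⟩
  have c2 : ∀ z, C2BddOn (fun t : Euc p × Euc q => Real.log (1 - M.D t.2 (M.G t.1 z))) S
      (C₂ * C₃ + C₂ * C₃ * C₃) := fun z =>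
    g2.comp (i2 z) fun t ht => ⟨M.G_mem t.1 ht.1 z, ht.2⟩
  set C₄ := (C₁ * ‖R‖ + C₁ * ‖R‖ * ‖R‖) + (C₂ * C₃ + C₂ * C₃ * C₃)
  have hlogκ : 0 ≤ -Real.log κ := neg_nonneg.2 (Real.log_nonpos hκ.le (by linarith))
  refine ⟨max (max C₄ 0) (-Real.log κ + -Real.log κ), fun t ht => h.measurable_contrib ht,
    fun w t ht => ?_, fun w => ?_⟩
  · by_cases hw : w.1 ∈ M.E
    · rw [contrib_of_mem hw]
      refine le_max_of_le_right ((norm_add_le _ _).trans (add_le_add ?_ ?_))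
      · have := hD t.2 ht.2 w.1 hw
        exact abs_log_le_of_mem_Icc hκ this.1 (by linarith)
      · have := hD t.2 ht.2 _ (M.G_mem t.1 ht.1 w.2)
        exact abs_log_le_of_mem_Icc hκ (by linarith) (by linarith)
    · rw [contrib_of_notMem hw, norm_zero]
      exact le_max_of_le_left (le_max_right _ _)
  · by_cases hw : w.1 ∈ M.E
    · rw [contrib_of_mem hw]
      exact ((c1 w.1 hw).add (c2 w.2)).mono subset_rfl
        ((le_max_left _ _).trans (le_max_left _ _))
    · rw [contrib_of_notMem hw]
      refine ((0 : Euc p × Euc q →L[ℝ] ℝ).c2BddOn S).mono subset_rfl ?_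
      rw [norm_zero]
      exact le_max_of_le_left (le_max_right _ _)

/-- The densities `p⋆` and `p_θ` only enter through the laws of `X 0` and `G_θ (Z 0)`. -/
theorem HReg.L_eq_integral_contrib (h : M.HReg) {Ω : Type*} [MeasurableSpace Ω] {P : Measure Ω}
    [IsProbabilityMeasure P] {X : ℕ → Ω → Euc d} {Z : ℕ → Ω → Euc d'} (hs : M.IsSample P X Z)
    {t : Euc p × Euc q} (ht : t ∈ M.Θ ×ˢ M.Λ) :
    M.L t.1 t.2 = ∫ ω, M.contrib (X 0 ω, Z 0 ω) t ∂P := by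
  obtain ⟨κ, hκ, hκ2, hD⟩ := h.regD.1
  have hm1 := h.measurable_log_D ht.2
  have hm2 := h.measurable_log_one_sub_D ht.2
  have hGZ : Measurable fun ω => M.G t.1 (Z 0 ω) := (M.measurable_G _ ht.1).comp (hs.measurable_Z 0)
  have hE : ∀ᵐ x ∂M.μ, x ∈ M.E := mem_ae_iff.2 M.μ_compl_E
  -- both integrals against densities are expectations
  have key : ∀ (ν : Measure (Euc d)) (ρ : Euc d → ℝ), Measurable ρ → (∀ x ∈ M.E, 0 ≤ ρ x) →
      (ν = M.μ.withDensity fun x => ENNReal.ofReal (ρ x)) → ∀ φ : ℝ → ℝ,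
      ∫ x, φ (M.D t.2 x) * ρ x ∂M.μ = ∫ x, φ (M.E.indicator (M.D t.2) x) ∂ν := by
    intro ν ρ hρ hρ0 hν φ
    rw [hν, integral_withDensity_eq_integral_toReal_smul hρ.ennreal_ofReal
      (ae_of_all _ fun x => ENNReal.ofReal_lt_top)]
    refine integral_congr_ae ?_
    filter_upwards [hE] with x hx
    rw [Set.indicator_of_mem hx, ENNReal.toReal_ofReal (hρ0 x hx), smul_eq_mul, mul_comm]
  have e1 : ∫ x, Real.log (M.D t.2 x) * M.pstar x ∂M.μ =
      ∫ ω, Real.log (M.E.indicator (M.D t.2) (X 0 ω)) ∂P := by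
    rw [key _ M.pstar M.measurable_pstar M.pstar_nonneg hs.map_X Real.log,
      integral_map (hs.measurable_X 0).aemeasurable hm1.aestronglyMeasurable]
  have e2 : ∫ x, Real.log (1 - M.D t.2 x) * M.dens t.1 x ∂M.μ =
      ∫ ω, Real.log (1 - M.E.indicator (M.D t.2) (M.G t.1 (Z 0 ω))) ∂P := by
    have hmap : P.map (fun ω => M.G t.1 (Z 0 ω)) =
        M.μ.withDensity fun x => ENNReal.ofReal (M.dens t.1 x) := by
      rw [← M.map_G t.1 ht.1, ← hs.map_Z, Measure.map_map (M.measurable_G _ ht.1)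
        (hs.measurable_Z 0)]
      rfl
    rw [key _ (M.dens t.1) (M.measurable_dens _ ht.1) (M.dens_nonneg _ ht.1) hmap
      fun y => Real.log (1 - y), integral_map hGZ.aemeasurable hm2.aestronglyMeasurable]
  have i1 : Integrable (fun ω => Real.log (M.E.indicator (M.D t.2) (X 0 ω))) P := by
    refine Integrable.of_bound (hm1.comp (hs.measurable_X 0)).aestronglyMeasurable (-Real.log κ) ?_
    filter_upwards [hs.X_mem] with ω hω
    rw [Set.indicator_of_mem (hω 0)]
    have := hD t.2 ht.2 _ (hω 0)
    exact abs_log_le_of_mem_Icc hκ this.1 (by linarith)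
  have i2 : Integrable (fun ω => Real.log (1 - M.E.indicator (M.D t.2) (M.G t.1 (Z 0 ω)))) P := by
    refine Integrable.of_bound (hm2.comp hGZ).aestronglyMeasurable (-Real.log κ) (ae_of_all _ fun ω => ?_)
    rw [Set.indicator_of_mem (M.G_mem t.1 ht.1 _)]
    have := hD t.2 ht.2 _ (M.G_mem t.1 ht.1 (Z 0 ω))
    exact abs_log_le_of_mem_Icc hκ (by linarith) (by linarith)
  rw [L, e1, e2, ← integral_add i1 i2]
  refine integral_congr_ae ?_
  filter_upwards [hs.X_mem] with ω hω
  rw [contrib_of_mem (hω 0), Set.indicator_of_mem (hω 0),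
    Set.indicator_of_mem (M.G_mem t.1 ht.1 _)]
  rfl

theorem Lhat_eq_sum_contrib {x : ℕ → Euc d} {z : ℕ → Euc d'} (hx : ∀ i, x i ∈ M.E) (n : ℕ)
    (t : Euc p × Euc q) :
    M.Lhat n x z t.1 t.2 = ∑ i ∈ Finset.range n, M.contrib (x i, z i) t := by
  rw [Lhat, ← Finset.sum_add_distrib]
  refine Finset.sum_congr rfl fun i _ => ?_
  rw [contrib_of_mem (hx i)]
  rfl

/-- When the inner maxima are attained, the two ways of expressing that a point minimizes the
supremum agree. -/
theorem isInfSup_iff_isMinimaxOn (hne : M.Λ.Nonempty) {F : Euc p → Euc q → ℝ}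
    (hF : ContinuousOn (fun t : Euc p × Euc q => F t.1 t.2) (M.Θ ×ˢ M.Λ)) (θ : Euc p) :
    M.IsInfSup F θ ↔ IsMinimaxOn M.Θ M.Λ (fun t => F t.1 t.2) θ := by
  have hsup : ∀ θ ∈ M.Θ, ∃ β ∈ M.Λ, (∀ α ∈ M.Λ, F θ α ≤ F θ β) ∧ (⨆ α : M.Λ, F θ α) = F θ β := by
    intro θ hθ
    obtain ⟨β, hβ, hmax⟩ := hF.exists_argmax M.isCompact_Λ hne hθ
    refine ⟨β, hβ, hmax, le_antisymm ?_ ?_⟩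
    · have : Nonempty M.Λ := ⟨⟨β, hβ⟩⟩
      exact ciSup_le fun α => hmax α α.2
    · refine le_ciSup (f := fun α : M.Λ => F θ α) ⟨F θ β, ?_⟩ ⟨β, hβ⟩
      rintro _ ⟨α, rfl⟩
      exact hmax α α.2
  constructor
  · rintro ⟨hθ, h⟩
    refine ⟨hθ, fun θ' hθ' => ?_⟩
    obtain ⟨β, hβ, hmax, he⟩ := hsup θ hθ
    obtain ⟨β', hβ', -, he'⟩ := hsup θ' hθ'
    refine ⟨β', hβ', fun α hα => (hmax α hα).trans ?_⟩
    have := h θ' hθ'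
    rwa [he, he'] at this
  · rintro ⟨hθ, h⟩
    refine ⟨hθ, fun θ' hθ' => ?_⟩
    obtain ⟨β, hβ, hmax, he⟩ := hsup θ hθ
    obtain ⟨β', hβ', hmax', he'⟩ := hsup θ' hθ'
    obtain ⟨γ, hγ, hle⟩ := h θ' hθ'
    rw [he, he']
    exact (hle β hβ).trans (hmax' γ hγ)

end GANModel

theorem mainTheorem1 {d d' p q : ℕ} (M : GANModel d d' p q)
    {Ω : Type*} [MeasurableSpace Ω] (P : Measure Ω) [IsProbabilityMeasure P]
    (X : ℕ → Ω → Euc d) (Z : ℕ → Ω → Euc d') (hXZ : M.IsSample P X Z)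
    (hreg : M.HReg)
    (θ₀ : Euc p) (α₀ : Euc q) (h1 : M.HOne θ₀ α₀)
    (U : Set (Euc p)) (a : Euc p → Euc q) (hloc : M.HLoc θ₀ α₀ U a)
    (θhat : ℕ → Ω → Euc p) (hmeas : ∀ n, AEMeasurable (θhat n) P)
    (hθhat : ∀ n, ∀ᵐ ω ∂P,
      M.IsInfSup (M.Lhat n (fun i => X i ω) (fun i => Z i ω)) (θhat n ω)) :
    MemLp (fun ω => M.influence θ₀ α₀ a (X 0 ω) (Z 0 ω)) 2 P ∧
    TendstoInDistribution (fun (n : ℕ) ω => Real.sqrt n • (θhat n ω - θ₀)) atTop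
      id (fun _ => P)
      (multivariateGaussian 0
        (covMat P fun ω => M.influence θ₀ α₀ a (X 0 ω) (Z 0 ω))) := by
  obtain ⟨C, hf⟩ := hreg.exists_isSmoothFamily
  have hne : M.Λ.Nonempty := ⟨α₀, h1.mem_argmax.1⟩
  have hid : ∀ i, IdentDistrib (fun ω => (X i ω, Z i ω)) (fun ω => (X 0 ω, Z 0 ω)) P P :=
    hXZ.identDistrib
  have hLf : ∀ t ∈ M.Θ ×ˢ M.Λ, M.L t.1 t.2 = ∫ ω, M.contrib (X 0 ω, Z 0 ω) t ∂P := fun t ht =>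
    hreg.L_eq_integral_contrib hXZ ht
  have hLc : ContinuousOn (fun t : Euc p × Euc q => M.L t.1 t.2) (M.Θ ×ˢ M.Λ) :=
    (hf.tendstoUniformlyOn (M.isCompact_Θ.prod M.isCompact_Λ) hXZ.indep hid).1.congr hLf
  have hΘ : M.Θ ∈ 𝓝 θ₀ := mem_interior_iff_mem_nhds.1 h1.mem_interior_Θ
  have hΛ : M.Λ ∈ 𝓝 α₀ := mem_interior_iff_mem_nhds.1 h1.mem_interior_Λ
  have ht₀ : interior (M.Θ ×ˢ M.Λ) ∈ 𝓝 (θ₀, α₀) :=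
    isOpen_interior.mem_nhds (mem_interior_iff_mem_nhds.2 (prod_mem_nhds hΘ hΛ))
  refine tendstoInDistribution_of_isMinimaxOn (W := fun i ω => (X i ω, Z i ω)) (f := M.contrib)
    (L := fun t => M.L t.1 t.2) M.isCompact_Θ M.isCompact_Λ hXZ.indep hid hf hLf hΘ hΛ
    ((M.isInfSup_iff_isMinimaxOn hne hLc θ₀).1 h1.isInfSup) (fun θ' hθ' => ?_)
    (fun α' hα' hmax => (h1.unique θ₀ α' h1.isInfSup ⟨hα', hmax⟩).2) (a := a) ?_
    rfl hloc.isUnit_HV rfl hloc.isUnit_H2L rfl hmeas (fun n => ?_)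
    (Y := fun w => M.influence θ₀ α₀ a w.1 w.2) ?_
  · obtain ⟨β, hβ, hmax⟩ := hLc.exists_argmax M.isCompact_Λ hne hθ'.1
    exact (h1.unique θ' β ((GANModel.isInfSup_iff_isMinimaxOn hne hLc θ').2 hθ') ⟨hβ, hmax⟩).1
  · filter_upwards [hloc.mem_nhds] with θ hθ
    have : a θ ∈ M.argmax M.L θ := by
      rw [hloc.argmax_eq θ hθ]
      rfl
    exact this
  · filter_upwards [hθhat n, hXZ.X_mem] with ω hω hE
    have hsum : (fun t : Euc p × Euc q => M.Lhat n (fun i => X i ω) (fun i => Z i ω) t.1 t.2) =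
        fun t => ∑ i ∈ Finset.range n, M.contrib (X i ω, Z i ω) t :=
      funext fun t => GANModel.Lhat_eq_sum_contrib hE n t
    have hc : ContinuousOn
        (fun t : Euc p × Euc q => M.Lhat n (fun i => X i ω) (fun i => Z i ω) t.1 t.2)
        (M.Θ ×ˢ M.Λ) := by
      rw [hsum]
      exact continuousOn_finsetSum _ fun i _ => (hf.c2BddOn _).continuousOn
    rw [← hsum]
    exact (GANModel.isInfSup_iff_isMinimaxOn hne hc _).1 hω
  · filter_upwards [hXZ.X_mem] with ω hE
    have hd : HasFDerivAt (M.contrib (X 0 ω, Z 0 ω))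
        (fderiv ℝ (M.contrib (X 0 ω, Z 0 ω)) (θ₀, α₀)) (θ₀, α₀) :=
      (((hf.c2BddOn (X 0 ω, Z 0 ω)).mono interior_subset le_rfl).fderiv_of_isOpen
        isOpen_interior).1 _ (mem_of_mem_nhds ht₀)
    have g1 := hd.gradient_fst
    have g2 := hd.gradient_snd
    rw [GANModel.contrib_of_mem (w := (X 0 ω, Z 0 ω)) (hE 0)] at g1 g2 ⊢
    rw [← g1, ← g2]
    rfl
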